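/- Let $n\ge 0$ be an integer, let $\Sigma$ be a Sylow $2$-subgroup of $\mathrm{Sym}(2^n)$ and let $T\le\Sigma$ be an elementary abelian regular subgroup. Define the normalizer chain by $N_0=N_\Sigma(T)$ and $N_i=N_\Sigma(N_{i-1})$ for $i\ge 1$. **Lie side.** Let $\mathfrak L$ be the free $\mathbb Z_2$-module with basis $\mathcal B=\{x^\Lambda\partial_k : 1\le k\le n,\ x^\Lambda \text{ a squarefree monomial in } x_1,\dots,x_{k-1}\}$, where $\Lambda$ is regarded as a partition into distinct parts, $\mathrm{supp}(\Lambda)$ is its set of parts and $x^\Lambda=\prod_{i\in\mathrm{supp}(\Lambda)}x_i$. The bracket on $\mathfrak L$ is the bilinear extension of $$[x^\Lambda\partial_k,x^\Theta\partial_j]=\partial_j(x^\Lambda)\,x^\Theta\,\partial_k-x^\Lambda\,\partial_k(x^\Theta)\,\partial_j ,$$ computed in $\mathbb Z_2[x_1,\dots,x_n]/(x_1^2,\dots,x_n^2)$. Let $\mathfrak T$ be the span of $\partial_1,\dots,\partial_n$, and let $\mathfrak N_0=N_{\mathfrak L}(\mathfrak T)$, $\mathfrak N_i=N_{\mathfrak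 L}(\mathfrak N_{i-1})$ for $i\ge1$, where $N_{\mathfrak L}(\mathfrak H)=\{z\in\mathfrak L : [z,h]\in\mathfrak H\text{ for all }h\in\mathfrak H\}$. Let $\mathcal N_0=\{\partial_1,\dots,\partial_n\}\cup\{x_j\partial_k: 1\le j<k\le n\}$ and, for $i\ge 1$, let $\mathcal N_i$ be the set of all $b\in\mathcal B$ such that, for every $h\in\mathcal N_{i-1}$, $[b,h]$ is a scalar multiple of an element of $\mathcal N_{i-1}$. **Rigid commutators.** For $1\le i\le n$ let $s_i$ be the permutation of $\{0,1\}^n$ that changes the $i$-th letter of a word if its first $i-1$ letters are all $0$, and fixes the word otherwise. For $X=\{x_1>x_2>\dots>x_\ell\}\subseteq\{1,\dots,n\}$ let $[X]$ be the left-normed commutator $[s_{x_1},s_{x_2},\dots,s_{x_\ell}]$, with $[\emptyset]=1$. For $1\le k\le n$ and $I\subseteq\{1,\dots,k-1\}$, the rigid commutator based at $k$ and punctured at $I$ is $[\{1,\dots,k\}\setminus I]$; let $t_k$ be the one with $I=\emptyset$, and let $\mathcal R^*$ be the set of all of them. A subset of $\mathcal R^*$ is *saturated* if its union with $\{1\}$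 is closed under commutators; a subgroup generated by a saturated set is called a saturated subgroup. Let $f(x^\Lambda\partial_k)$ be the rigid commutator based at $k$ and punctured at $\mathrm{supp}(\Lambda)$. **Theorem.** 1. There is a bijection between the $2^n$ points and $\{0,1\}^n$ that carries $\Sigma$ to $\langle s_1,\dots,s_n\rangle$ and $T$ to $\langle t_1,\dots,t_n\rangle$. 2. Under every such bijection and for every $i\ge 0$, the set $f(\mathcal N_i)$ is saturated, $N_i$ is carried to the saturated subgroup $\langle f(\mathcal N_i)\rangle$, and $f(\mathcal N_i)$ is the set of all elements of $\mathcal R^*$ that lie in this subgroup. 3. For every $i\ge 1$, $$\mathrm{rk}(\mathfrak N_i/\mathfrak N_{i-1})=\log_2|N_i:N_{i-1}| .$$ -/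

import Mathlib

/-! ### The Lie ring of partitions -/

namespace PartLie

/-- The basis `𝓑` of the Lie ring of partitions: an element is `x^Λ ∂_k` where `1 ≤ k ≤ n` and `Λ` is
a partition with parts `< k`, each of multiplicity at most `m - 1`.
Indices are shifted: the part (variable, derivation) with number `j + 1` is indexed by `j : Fin n`,
and `expo j` is the multiplicity of that part. -/
@[ext]
structure BasisElt (m n : ℕ) where
  expo : Fin n → ℕ
  idx : Fin n
  expo_lt : ∀ j, expo j < m
  supp_lt : ∀ j, expo j ≠ 0 → j < idx

/-- The support `supp Λ`, for the basis element `x^Λ ∂_k`. -/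
def BasisElt.supp {m n : ℕ} (b : BasisElt m n) : Finset (Fin n) :=
  Finset.univ.filter fun j => b.expo j ≠ 0

/-- The underlying free `ℤ_m`-module, with basis `𝓑`, of the Lie ring of partitions. -/
abbrev LieRingOfPartitions (m n : ℕ) : Type := BasisElt m n →₀ ZMod m

/-- The element `1 • b` of the free module. -/
noncomputable def BasisElt.toLie {m n : ℕ} (b : BasisElt m n) : LieRingOfPartitions m n :=
  Finsupp.single b 1

open Classical in
/-- `x^Γ ∂_u` for an exponent vector `Γ` involving only variables below `u`;
it is zero as soon as some exponent is at least `m`, since `x_j ^ m = 0`. -/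
noncomputable def monomialDer (m : ℕ) {n : ℕ} (Γ : Fin n → ℕ) (u : Fin n) :
    LieRingOfPartitions m n :=
  if h : (∀ j, Γ j < m) ∧ (∀ j, Γ j ≠ 0 → j < u) then
    BasisElt.toLie ⟨Γ, u, h.1, h.2⟩
  else 0

/-- The bracket of two basis elements:
`[x^Λ ∂_k, x^Θ ∂_j] = ∂_j(x^Λ) x^Θ ∂_k` if `j < k`, it is `- x^Λ ∂_k(x^Θ) ∂_j` if `k < j`,
and `0` if `j = k`.
(If the exponent that is lowered is zero, then the coefficient in front vanishes.) -/
noncomputable def basisBracket {m n : ℕ} (a b : BasisElt m n) : LieRingOfPartitions m n :=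
  if b.idx < a.idx then
    (a.expo b.idx : ZMod m) • monomialDer m (a.expo - Pi.single b.idx 1 + b.expo) a.idx
  else if a.idx < b.idx then
    -((b.expo a.idx : ZMod m) • monomialDer m (a.expo + (b.expo - Pi.single a.idx 1)) b.idx)
  else 0

/-- The Lie bracket: the bilinear extension of the bracket of basis elements. -/
noncomputable def bracket (m n : ℕ) :
    LieRingOfPartitions m n →ₗ[ZMod m] LieRingOfPartitions m n →ₗ[ZMod m]
      LieRingOfPartitions m n :=
  Finsupp.linearCombination (ZMod m) fun a : BasisElt m n =>
    Finsupp.linearCombination (ZMod m) fun b : BasisElt m n => basisBracket a b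

/-- The idealizer `{z | [z, h] ∈ H for all h ∈ H}` of a submodule `H`. -/
noncomputable def idealizer {m n : ℕ} (H : Submodule (ZMod m) (LieRingOfPartitions m n)) :
    Submodule (ZMod m) (LieRingOfPartitions m n) where
  carrier := {z | ∀ h ∈ H, bracket m n z h ∈ H}
  add_mem' := fun {x y} hx hy h hh => by
    rw [map_add, LinearMap.add_apply]
    exact H.add_mem (hx h hh) (hy h hh)
  zero_mem' := fun h _ => by
    rw [map_zero, LinearMap.zero_apply]
    exact H.zero_mem
  smul_mem' := fun c x hx h hh => by
    rw [map_smul, LinearMap.smul_apply]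
    exact H.smul_mem c (hx h hh)

/-- The set `𝓣 = {∂_1, …, ∂_n}`. -/
def basisT (m n : ℕ) : Set (BasisElt m n) := {b | b.expo = 0}

/-- The idealizer chain `𝔑_0 = N(𝔗)`, `𝔑_{i+1} = N(𝔑_i)`, where `𝔗` is the span of `𝓣`. -/
noncomputable def idealizerChain (m n : ℕ) :
    ℕ → Submodule (ZMod m) (LieRingOfPartitions m n)
  | 0 => idealizer (Submodule.span (ZMod m) (BasisElt.toLie '' basisT m n))
  | i + 1 => idealizer (idealizerChain m n i)

/-- The idealizer in `𝓑` of a set `H ⊆ 𝓑`: all `b ∈ 𝓑` such that, for every `h ∈ H`, the bracket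
`[b, h]` is a scalar multiple of an element of `H`. -/
def basisIdealizer {m n : ℕ} (H : Set (BasisElt m n)) : Set (BasisElt m n) :=
  {b | ∀ h ∈ H, ∃ (a : ZMod m) (c : BasisElt m n), c ∈ H ∧
    bracket m n b.toLie h.toLie = a • c.toLie}

/-- The set `𝓤 = 𝓣 ∪ {x_j ∂_k | j < k}`. -/
def basisU (m n : ℕ) : Set (BasisElt m n) :=
  basisT m n ∪ {b | ∃ j, b.expo = Pi.single j 1}

/-- The sets `𝓝_0 = 𝓤`, `𝓝_{i+1} = N_𝓑(𝓝_i)`. -/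
def basisChain (m n : ℕ) : ℕ → Set (BasisElt m n)
  | 0 => basisU m n
  | i + 1 => basisIdealizer (basisChain m n i)

/-- The rank of the quotient module `B / A`, for submodules `A ≤ B`. -/
noncomputable def quotientRank {R M : Type*} [CommRing R] [AddCommGroup M] [Module R M]
    (B A : Submodule R M) : ℕ :=
  Module.finrank R (B ⧸ A.submoduleOf B)

end PartLie

/-! ### Rigid commutators and the normalizer chain -/

namespace RigidComm

open scoped commutatorElement

/-- The `2 ^ n` points: words of length `n` over `{0, 1}`, the letter number `j + 1` being
indexed by `j : Fin n`. -/
abbrev Word (n : ℕ) : Type := Fin n → ZMod 2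

/-- The underlying map of the generator `s_i`: it changes the letter number `i` of a word if all
the earlier letters are `0`, and fixes the word otherwise. -/
def flip {n : ℕ} (i : Fin n) (w : Word n) : Word n :=
  if ∀ j < i, w j = 0 then Function.update w i (w i + 1) else w

theorem flip_involutive {n : ℕ} (i : Fin n) : Function.Involutive (flip i) := by
  intro w
  by_cases h : ∀ j < i, w j = 0
  · have h' : ∀ j < i, Function.update w i (w i + 1) j = 0 := fun j hj => by
      rw [Function.update_of_ne hj.ne]
      exact h j hj
    have h2 : w i + 1 + 1 = w i := by
      rw [add_assoc, CharTwo.add_self_eq_zero, add_zero]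
    have h1 : flip i w = Function.update w i (w i + 1) := if_pos h
    rw [h1]
    refine (if_pos h').trans ?_
    rw [Function.update_self, Function.update_idem, h2,
      Function.update_eq_self]
  · have h1 : flip i w = w := if_neg h
    rw [h1, h1]

/-- The generator `s_i` of the Sylow `2`-subgroup `⟨s_1, …, s_n⟩`
(the iterated wreath product of `n` copies of the group of order two). -/
def gen {n : ℕ} (i : Fin n) : Equiv.Perm (Word n) := (flip_involutive i).toPerm

/-- The left-normed commutator `[g_1, g_2, …, g_l] = [… [[g_1, g_2], g_3] …, g_l]` of a list;
it is `1` for the empty list. -/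
def leftNormed {G : Type*} [Group G] : List G → G
  | [] => 1
  | g :: l => l.foldl (fun a b => ⁅a, b⁆) g

/-- `[X] = [s_{x_1}, …, s_{x_l}]` for `X = {x_1 > … > x_l}`. -/
def rigid {n : ℕ} (X : Finset (Fin n)) : Equiv.Perm (Word n) :=
  leftNormed ((X.sort (fun a b => a ≥ b)).map gen)

/-- The rigid commutator based at `b` and punctured at `I`. -/
def punctured {n : ℕ} (b : Fin n) (I : Finset (Fin n)) : Equiv.Perm (Word n) :=
  rigid (Finset.Iic b \ I)

/-- The set `𝓡*` of the rigid commutators based at some `b` and punctured at some subset of the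
indices below `b`. -/
def rigidCommutators (n : ℕ) : Set (Equiv.Perm (Word n)) :=
  {g | ∃ (b : Fin n) (I : Finset (Fin n)), I ⊆ Finset.Iio b ∧ g = punctured b I}

/-- A set of rigid commutators is saturated if, together with the trivial commutator `[∅] = 1`,
it is closed under commutation. -/
def IsSaturated {n : ℕ} (S : Set (Equiv.Perm (Word n))) : Prop :=
  S ⊆ rigidCommutators n ∧ ∀ g ∈ S, ∀ h ∈ S, ⁅g, h⁆ ∈ insert 1 S

/-- The Sylow `2`-subgroup `⟨s_1, …, s_n⟩`. -/
def stdSylow (n : ℕ) : Subgroup (Equiv.Perm (Word n)) :=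
  Subgroup.closure (Set.range gen)

/-- The subgroup `⟨t_1, …, t_n⟩`, where `t_i` is based at `i` and punctured at `∅`. -/
def stdT (n : ℕ) : Subgroup (Equiv.Perm (Word n)) :=
  Subgroup.closure (Set.range fun i : Fin n => punctured i ∅)

/-- The map `f` from the basis of the Lie ring to the rigid commutators:
`f (x^Λ ∂_k)` is based at `k` and punctured at `supp Λ`. -/
def toRigid {n : ℕ} (b : PartLie.BasisElt 2 n) : Equiv.Perm (Word n) :=
  punctured b.idx b.supp

/-- The normalizer chain in `S` starting from `T`: `N_0 = N_S(T)` and `N_{i+1} = N_S(N_i)`. -/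
def normalizerChain {G : Type*} [Group G] (S T : Subgroup G) : ℕ → Subgroup G
  | 0 => S ⊓ Subgroup.normalizer (T : Set G)
  | i + 1 => S ⊓ Subgroup.normalizer (normalizerChain S T i : Set G)

/-- An abelian group all of whose elements satisfy `g ^ 2 = 1`. -/
def IsElementaryAbelianTwo {G : Type*} [Group G] (T : Subgroup G) : Prop :=
  (∀ g ∈ T, ∀ h ∈ T, g * h = h * g) ∧ ∀ g ∈ T, g ^ 2 = 1

/-- A permutation group is regular if exactly one of its elements takes a given point to a given
point. -/
def IsRegular {α : Type*} (T : Subgroup (Equiv.Perm α)) : Prop :=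
  ∀ x y : α, ∃! g : Equiv.Perm α, g ∈ T ∧ g x = y

/-- The subgroup of `Sym β` that corresponds to `H ≤ Sym α` under a bijection `α ≃ β`. -/
def transport {α β : Type*} (e : α ≃ β) (H : Subgroup (Equiv.Perm α)) :
    Subgroup (Equiv.Perm β) :=
  H.map e.permCongrHom.toMonoidHom

end RigidComm

/-!
A word is a function `Fin n → ZMod 2`, and the functions on words are polynomials in the idempotent
variables `y_i = 1 + w_i`. The rigid commutator based at `k` and punctured at `A` adds to the letter
`k` the value of the monomial `y_A` (`isShear_punctured`), and the Sylow subgroup `⟨s_1, …, s_n⟩` is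
the group of triangular permutations, which change each letter by a polynomial in the earlier ones,
the *component* of the permutation at that letter. For `j ∈ A` the commutator of `y_A ∂_k` and
`y_B ∂_j` is `y_{(A \ j) ∪ B} ∂_k`, as in the Lie ring, except that there a product of overlapping
monomials is zero.

*Groups.* If a family of monomials is closed under these commutators, then its group consists of the
triangular permutations whose components are combinations of the monomials in the family
(`IsClosedFamily.mem_closure_iff`). So its order is `2` to the number of these monomials. If the
family contains the translations, then it is closed under taking divisors, and the normalizer of its
group is the group of the family of the monomials that normalize it
(`IsClosedFamily.normalizer_closure`). The point is that the monomials of the leading component `c`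
at `m` of a normalizing element `g` can be separated. For a monomial `y_B ∂_j` of the family with
`j < m` the derivative `∂_j c` times `y_B` lies in the space of the family at `m`. If `m ∈ B`, then
`y_B ∘ g` lies in the space of the family at `j`, and there its part divisible by the letters of `B`
above `m` is controlled by `c` times the monomial of the letters of `B` below `m`
(`coef_mono_comp_mul`). Both facts hold for the divisors of `y_B` as well, which excludes
cancellations (`union_mem_of_mul_mono_mem`).

*Lie ring.* Bracketing with a basis element is injective on the basis elements that it does not
kill, so that the idealizer of a span of basis elements is spanned by the basis idealizer
(`PartLie.idealizer_span`). Since overlaps can be removed by passing to divisors, the basis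
idealizer has the same monomials as the normalizer family (`PartLie.familyOf_basisIdealizer`).
Hence both chains are given by the same sets `𝓝_i`, and the ranks and the indices agree.

*Conjugacy.* By order, the group of triangular permutations is a Sylow subgroup. An elementary
abelian regular subgroup `T` of it is generated by the elements `t_j` that map the zero word to
`e_j`, and `v ↦ (∏ j, t_j ^ v_j) 0` is a triangular permutation that conjugates the translations
into `T` (`exists_transport_eq_stdT`).
-/

namespace RigidComm

open scoped commutatorElement

/-! ### Monomials in the complemented variables -/

variable {n : ℕ}

/-- The monomial `∏ i ∈ A, (1 + w i)` as a function on words: the indicator function of the words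
that vanish on `A`. -/
def mono (A : Finset (Fin n)) (w : Word n) : ZMod 2 := if ∀ i ∈ A, w i = 0 then 1 else 0

theorem mono_empty : mono (∅ : Finset (Fin n)) = 1 := by
  funext w; simp [mono]

theorem mono_mul_mono (A B : Finset (Fin n)) : mono A * mono B = mono (A ∪ B) := by
  funext w
  simp only [mono, Pi.mul_apply, Finset.mem_union, or_imp, forall_and]
  split_ifs <;> simp_all

theorem mono_singleton_apply (i : Fin n) (w : Word n) : mono {i} w = 1 + w i := by
  have : ∀ x : ZMod 2, (if x = 0 then 1 else 0) = 1 + x := by decide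
  simp [mono, this]

theorem mono_eq_mul_erase {A : Finset (Fin n)} {i : Fin n} (hi : i ∈ A) :
    mono A = mono {i} * mono (A.erase i) := by
  rw [mono_mul_mono, ← Finset.insert_eq, Finset.insert_erase hi]

theorem dependsOn_mono (A : Finset (Fin n)) : DependsOn (mono A) (A : Set (Fin n)) := by
  intro v w h
  have : (∀ i ∈ A, v i = 0) ↔ ∀ i ∈ A, w i = 0 :=
    forall₂_congr fun i hi => by rw [h i hi]
  simp only [mono, this]

/-- The discrete partial derivative `u(w) + u(w + e_i)` of a function on words. -/
def partialDeriv (i : Fin n) : (Word n → ZMod 2) →ₗ[ZMod 2] (Word n → ZMod 2) where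
  toFun u w := u w + u (w + Pi.single i 1)
  map_add' u v := by funext w; simp only [Pi.add_apply]; ring
  map_smul' c u := by funext w; simp only [Pi.smul_apply, smul_eq_mul, RingHom.id_apply]; ring

theorem partialDeriv_apply (i : Fin n) (u : Word n → ZMod 2) (w : Word n) :
    partialDeriv i u w = u w + u (w + Pi.single i 1) := rfl

theorem apply_add_single (u : Word n → ZMod 2) (w : Word n) (j : Fin n) (c : ZMod 2) :
    u (w + Pi.single j c) = u w + c * partialDeriv j u w := by
  have hc : c = 0 ∨ c = 1 := by revert c; decide
  rcases hc with rfl | rfl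
  · simp
  · rw [partialDeriv_apply, one_mul, ← add_assoc, CharTwo.add_self_eq_zero, zero_add]

theorem partialDeriv_eq_zero {u : Word n → ZMod 2} {s : Set (Fin n)} (hu : DependsOn u s)
    {i : Fin n} (hi : i ∉ s) : partialDeriv i u = 0 := by
  funext w
  rw [partialDeriv_apply, hu (x := w + Pi.single i 1) (y := w), CharTwo.add_self_eq_zero]
  · rfl
  · intro j hj
    have : j ≠ i := fun h => hi (h ▸ hj)
    simp [this]

theorem partialDeriv_mono_singleton_mul {v : Word n → ZMod 2} {s : Set (Fin n)} {i : Fin n}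
    (hv : DependsOn v s) (hi : i ∉ s) : partialDeriv i (mono {i} * v) = v := by
  have h := partialDeriv_eq_zero hv hi
  funext w
  have hw : v w + v (w + Pi.single i 1) = 0 := by
    rw [← partialDeriv_apply, h]; rfl
  have hw' : v (w + Pi.single i 1) = v w := (CharTwo.add_eq_zero.mp hw).symm
  simp only [partialDeriv_apply, Pi.mul_apply, mono_singleton_apply, Pi.add_apply,
    Pi.single_eq_same, hw']
  generalize v w = a
  generalize w i = b
  revert a b; decide

theorem partialDeriv_mono (i : Fin n) (A : Finset (Fin n)) :
    partialDeriv i (mono A) = if i ∈ A then mono (A.erase i) else 0 := by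
  split_ifs with hi
  · rw [mono_eq_mul_erase hi]
    exact partialDeriv_mono_singleton_mul (dependsOn_mono _) (by simp)
  · exact partialDeriv_eq_zero (dependsOn_mono A) (by simpa using hi)

theorem linearIndependent_mono :
    LinearIndependent (ZMod 2) (mono : Finset (Fin n) → Word n → ZMod 2) := by
  rw [Fintype.linearIndependent_iff]
  intro c hc A
  induction A using Finset.strongInduction with
  | H A ih =>
    -- at the word with zero set `A` exactly the monomials of subsets of `A` do not vanish
    have h := congrFun hc (fun i => if i ∈ A then 0 else 1)
    rw [Finset.sum_apply, Finset.sum_eq_single A] at h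
    · simpa [mono] using h
    · intro B _ hB
      by_cases hBA : B ⊆ A
      · simp [ih B (Finset.ssubset_iff_subset_ne.mpr ⟨hBA, hB⟩)]
      · obtain ⟨i, hiB, hiA⟩ := Finset.not_subset.mp hBA
        have : ¬ ∀ i ∈ B, (if i ∈ A then (0 : ZMod 2) else 1) = 0 :=
          fun h => by simpa [hiA] using h i hiB
        simp only [Pi.smul_apply, mono, if_neg this, smul_zero]
    · simp

/-- The monomials form a basis of the space of functions on words. -/
noncomputable def monoBasis (n : ℕ) :
    Module.Basis (Finset (Fin n)) (ZMod 2) (Word n → ZMod 2) :=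
  basisOfLinearIndependentOfCardEqFinrank linearIndependent_mono (by simp)

theorem monoBasis_apply (A : Finset (Fin n)) : monoBasis n A = mono A := by
  simp [monoBasis]

/-- The coefficient of the monomial of `A` in `u`. -/
noncomputable def coef (A : Finset (Fin n)) : (Word n → ZMod 2) →ₗ[ZMod 2] ZMod 2 :=
  (monoBasis n).coord A

theorem coef_mono (A B : Finset (Fin n)) : coef A (mono B) = if B = A then 1 else 0 := by
  rw [coef, ← monoBasis_apply, Module.Basis.coord_apply, Module.Basis.repr_self,
    Finsupp.single_apply]

/-- The span of the monomials of the members of `𝓐`. -/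
def monoSpan (𝓐 : Set (Finset (Fin n))) : Submodule (ZMod 2) (Word n → ZMod 2) :=
  Submodule.span (ZMod 2) (mono '' 𝓐)

theorem mem_monoSpan {𝓐 : Set (Finset (Fin n))} {u : Word n → ZMod 2} :
    u ∈ monoSpan 𝓐 ↔ ∀ A, coef A u ≠ 0 → A ∈ 𝓐 := by
  have h : (mono : Finset (Fin n) → Word n → ZMod 2) = monoBasis n :=
    funext fun A => (monoBasis_apply A).symm
  rw [monoSpan, h, Module.Basis.mem_span_image]
  simp [Set.subset_def, coef]

theorem mono_mem_monoSpan {𝓐 : Set (Finset (Fin n))} {A : Finset (Fin n)} :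
    mono A ∈ monoSpan 𝓐 ↔ A ∈ 𝓐 := by
  rw [mem_monoSpan]
  simp [coef_mono]

theorem finrank_monoSpan (𝓐 : Set (Finset (Fin n))) :
    Module.finrank (ZMod 2) (monoSpan 𝓐) = 𝓐.ncard := by
  classical
  have h : LinearIndependent (ZMod 2) (fun A : 𝓐 => mono (A : Finset (Fin n))) :=
    linearIndependent_mono.comp _ Subtype.val_injective
  have := finrank_span_eq_card h
  rw [monoSpan, Set.image_eq_range, this, Set.ncard_eq_toFinset_card', Set.toFinset_card]

theorem coef_partialDeriv {i : Fin n} {C : Finset (Fin n)} (hi : i ∉ C) (u : Word n → ZMod 2) :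
    coef C (partialDeriv i u) = coef (insert i C) u := by
  suffices h : (coef C).comp (partialDeriv i) = coef (insert i C) from LinearMap.congr_fun h u
  refine (monoBasis n).ext fun A => ?_
  rw [monoBasis_apply, LinearMap.comp_apply, partialDeriv_mono, coef_mono]
  split_ifs with h1 h2 h2
  · subst h2; simp [coef_mono, Finset.erase_insert hi]
  · rw [coef_mono, if_neg]
    rintro rfl
    exact h2 (Finset.insert_erase h1).symm
  · subst h2; simp at h1
  · simp

theorem coef_mul_mono_singleton {i : Fin n} {C : Finset (Fin n)} (hi : i ∈ C)
    (u : Word n → ZMod 2) :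
    coef C (u * mono {i}) = coef C u + coef (C.erase i) u := by
  suffices h : (coef C).comp (LinearMap.mulRight (ZMod 2) (mono {i})) = coef C + coef (C.erase i)
    from LinearMap.congr_fun h u
  refine (monoBasis n).ext fun A => ?_
  rw [monoBasis_apply, LinearMap.comp_apply, LinearMap.mulRight_apply, mono_mul_mono,
    LinearMap.add_apply, coef_mono, coef_mono, coef_mono, Finset.union_comm, ← Finset.insert_eq]
  by_cases hA : i ∈ A
  · have h2 : A ≠ C.erase i := by rintro rfl; simp at hA
    rw [Finset.insert_eq_of_mem hA, if_neg h2, add_zero]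
  · have h2 : A ≠ C := by rintro rfl; exact hA hi
    have h3 : insert i A = C ↔ A = C.erase i := by
      constructor
      · rintro rfl; rw [Finset.erase_insert hA]
      · rintro rfl; rw [Finset.insert_erase hi]
    simp [h2, h3]

theorem subset_of_coef_ne_zero {u : Word n → ZMod 2} {s : Set (Fin n)} (hu : DependsOn u s)
    {A : Finset (Fin n)} (hA : coef A u ≠ 0) : (A : Set (Fin n)) ⊆ s := by
  intro i hi
  by_contra his
  rw [← Finset.insert_erase (Finset.mem_coe.mp hi),
    ← coef_partialDeriv (Finset.notMem_erase i A), partialDeriv_eq_zero hu his] at hA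
  simp at hA

theorem dependsOn_of_mem_monoSpan {𝓐 : Set (Finset (Fin n))} {s : Set (Fin n)}
    (h𝓐 : ∀ A ∈ 𝓐, (A : Set (Fin n)) ⊆ s) {u : Word n → ZMod 2} (hu : u ∈ monoSpan 𝓐) :
    DependsOn u s := by
  intro v w hvw
  induction hu using Submodule.span_induction with
  | mem x hx =>
    obtain ⟨A, hA, rfl⟩ := hx
    exact dependsOn_mono A fun i hi => hvw i (h𝓐 A hA hi)
  | zero => rfl
  | add x y _ _ hx hy => simp only [Pi.add_apply, hx, hy]
  | smul a x _ hx => simp only [Pi.smul_apply, hx]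

/-- The terms of `u` can be separated although the products of distinct monomials with the monomial
of `B` may coincide, because all subsets of `B` are available as multipliers. -/
theorem union_mem_of_mul_mono_mem {𝓐 : Set (Finset (Fin n))} (B : Finset (Fin n))
    {u : Word n → ZMod 2} (h : ∀ B' ⊆ B, u * mono B' ∈ monoSpan 𝓐) {A : Finset (Fin n)}
    (hA : coef A u ≠ 0) : A ∪ B ∈ 𝓐 := by
  induction B using Finset.induction_on generalizing u A with
  | empty =>
    have := h ∅ subset_rfl
    rw [mono_empty, mul_one, mem_monoSpan] at this
    simpa using this A hA
  | insert i B hi ih =>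
    have h1 : ∀ B' ⊆ B, u * mono B' ∈ monoSpan 𝓐 :=
      fun B' hB' => h B' (hB'.trans (Finset.subset_insert i B))
    have h2 : ∀ B' ⊆ B, u * mono {i} * mono B' ∈ monoSpan 𝓐 := fun B' hB' => by
      rw [mul_assoc, mono_mul_mono, ← Finset.insert_eq]
      exact h _ (Finset.insert_subset_insert i hB')
    rw [Finset.union_insert, ← Finset.insert_union]
    by_cases hc : coef (insert i A) u = 0
    · refine ih h2 ?_
      have hiA : i ∉ A := fun hiA => hA (by rwa [Finset.insert_eq_of_mem hiA] at hc)
      rwa [coef_mul_mono_singleton (Finset.mem_insert_self i A), hc, zero_add,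
        Finset.erase_insert hiA]
    · exact ih h1 hc

/-! ### Rigid commutators as shears -/

/-- The permutation `g` adds `u(w)` to the letter `k` of the word `w` and fixes the other letters. -/
def IsShear (g : Equiv.Perm (Word n)) (k : Fin n) (u : Word n → ZMod 2) : Prop :=
  ∀ w, g w = w + Pi.single k (u w)

theorem IsShear.eq {g h : Equiv.Perm (Word n)} {k : Fin n} {u : Word n → ZMod 2}
    (hg : IsShear g k u) (hh : IsShear h k u) : g = h :=
  Equiv.ext fun w => by rw [hg w, hh w]

theorem isShear_one (k : Fin n) : IsShear (1 : Equiv.Perm (Word n)) k 0 := fun w => by simp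

theorem add_single_add_single (w : Word n) (k : Fin n) (a : ZMod 2) :
    w + Pi.single k a + Pi.single k a = w := by
  rw [add_assoc, ← Pi.single_add, CharTwo.add_self_eq_zero, Pi.single_zero, add_zero]

theorem apply_add_single_of_dependsOn {k j : Fin n} {u : Word n → ZMod 2}
    (hu : DependsOn u (Set.Iio k)) (hkj : k ≤ j) (w : Word n) (c : ZMod 2) :
    u (w + Pi.single j c) = u w := by
  apply hu
  intro i hi
  have : i ≠ j := (lt_of_lt_of_le hi hkj).ne
  simp [this]

theorem IsShear.mul {g h : Equiv.Perm (Word n)} {k : Fin n} {u v : Word n → ZMod 2}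
    (hu : DependsOn u (Set.Iio k)) (hg : IsShear g k u) (hh : IsShear h k v) :
    IsShear (g * h) k (u + v) := fun w => by
  rw [Equiv.Perm.mul_apply, hh w, hg, apply_add_single_of_dependsOn hu le_rfl, add_assoc,
    ← Pi.single_add, Pi.add_apply, add_comm (v w)]

theorem IsShear.inv_eq {g : Equiv.Perm (Word n)} {k : Fin n} {u : Word n → ZMod 2}
    (hu : DependsOn u (Set.Iio k)) (hg : IsShear g k u) : g⁻¹ = g := by
  refine inv_eq_of_mul_eq_one_left (Equiv.ext fun w => ?_)
  rw [Equiv.Perm.mul_apply, hg w, hg, apply_add_single_of_dependsOn hu le_rfl,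
    add_single_add_single, Equiv.Perm.one_apply]

theorem IsShear.commutator {g h : Equiv.Perm (Word n)} {j k : Fin n} (hjk : j < k)
    {u v : Word n → ZMod 2} (hu : DependsOn u (Set.Iio k)) (hv : DependsOn v (Set.Iio j))
    (hg : IsShear g k u) (hh : IsShear h j v) :
    IsShear ⁅g, h⁆ k (v * partialDeriv j u) := fun w => by
  rw [commutatorElement_def, hg.inv_eq hu, hh.inv_eq hv]
  simp only [Equiv.Perm.mul_apply]
  have h1 : g (h w) = w + Pi.single k (u (h w)) + Pi.single j (v w) := by
    rw [hg, hh w]; abel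
  have h2 : h (g (h w)) = w + Pi.single k (u (h w)) := by
    rw [hh, h1, apply_add_single_of_dependsOn hv le_rfl,
      apply_add_single_of_dependsOn hv hjk.le, add_single_add_single]
  rw [h2, hg, apply_add_single_of_dependsOn hu le_rfl, add_assoc, ← Pi.single_add, hh w,
    apply_add_single u, add_right_comm, CharTwo.add_self_eq_zero, zero_add, Pi.mul_apply]

theorem dependsOn_mono_Iio {k : Fin n} {A : Finset (Fin n)} (hA : A ⊆ Finset.Iio k) :
    DependsOn (mono A) (Set.Iio k) :=
  (dependsOn_mono A).mono fun _ hi => Finset.mem_Iio.mp (hA hi)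

theorem isShear_gen (i : Fin n) : IsShear (gen i) i (mono (Finset.Iio i)) := fun w => by
  change flip i w = _
  simp only [flip, mono, Finset.mem_Iio]
  split_ifs with h
  · funext j
    rcases eq_or_ne j i with rfl | hj
    · simp
    · simp [hj]
  · simp

theorem isShear_foldl_commutator (k : Fin n) (l : List (Fin n)) (hl : l.SortedGT)
    (J : Finset (Fin n)) (hJ : J ⊆ Finset.Iio k) (hlJ : ∀ x ∈ l, Finset.Iic x ⊆ J)
    (g : Equiv.Perm (Word n)) (hg : IsShear g k (mono J)) :
    IsShear ((l.map gen).foldl (fun a b => ⁅a, b⁆) g) k (mono (J \ l.toFinset)) := by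
  induction l generalizing J g with
  | nil => simpa using hg
  | cons x l ih =>
    have hxJ : x ∈ J := hlJ x (by simp) (by simp)
    have hlt : ∀ y ∈ l, y < x := fun y hy =>
      List.rel_of_pairwise_cons (List.sortedGT_iff_pairwise.mp hl) hy
    have h1 : IsShear ⁅g, gen x⁆ k (mono (J.erase x)) := by
      have := hg.commutator (Finset.mem_Iio.mp (hJ hxJ)) (dependsOn_mono_Iio hJ)
        (dependsOn_mono_Iio subset_rfl) (isShear_gen x)
      rw [partialDeriv_mono, if_pos hxJ, mono_mul_mono, Finset.union_eq_right.mpr] at this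
      · exact this
      · intro y hy
        have hy' := Finset.mem_Iio.mp hy
        exact Finset.mem_erase.mpr ⟨hy'.ne, hlJ x (by simp) (Finset.mem_Iic.mpr hy'.le)⟩
    have h2 := ih
      (List.sortedGT_iff_pairwise.mpr (List.sortedGT_iff_pairwise.mp hl).of_cons) (J.erase x)
      ((Finset.erase_subset _ _).trans hJ) (fun y hy z hz => by
        have hz' := (Finset.mem_Iic.mp hz).trans_lt (hlt y hy)
        exact Finset.mem_erase.mpr ⟨hz'.ne, hlJ x (by simp) (Finset.mem_Iic.mpr hz'.le)⟩)
      ⁅g, gen x⁆ h1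
    rw [List.toFinset_cons, Finset.sdiff_insert, ← Finset.erase_sdiff_comm]
    exact h2

theorem sort_Iic_sdiff (k : Fin n) {A : Finset (Fin n)} (hA : A ⊆ Finset.Iio k) :
    (Finset.Iic k \ A).sort (fun a b => a ≥ b) =
      k :: (Finset.Iio k \ A).sort (fun a b => a ≥ b) := by
  have h : Finset.Iic k \ A = Finset.cons k (Finset.Iio k \ A) (by simp) := by
    ext i
    have := @hA i
    simp only [Finset.mem_sdiff, Finset.mem_Iic, Finset.mem_cons, Finset.mem_Iio] at this ⊢
    grind
  rw [h]
  refine Finset.sort_cons (r := fun a b => a ≥ b) (fun b hb => ?_) (by simp)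
  exact (Finset.mem_Iio.mp (Finset.mem_sdiff.mp hb).1).le

/-- The rigid commutator based at `k` and punctured at `A` adds to the letter `k` the value of the
monomial of `A`: commuting with `s_x` differentiates in the direction `x`, and the factor
contributed by `s_x` is absorbed since monomials are idempotent. -/
theorem isShear_punctured {k : Fin n} {A : Finset (Fin n)} (hA : A ⊆ Finset.Iio k) :
    IsShear (punctured k A) k (mono A) := by
  rw [punctured, rigid, sort_Iic_sdiff k hA, List.map_cons, leftNormed]
  have := isShear_foldl_commutator k ((Finset.Iio k \ A).sort (fun a b => a ≥ b))
    (Finset.sortedGT_sort _) (Finset.Iio k) subset_rfl (fun x hx y hy => by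
      have := (Finset.mem_sdiff.mp ((Finset.mem_sort _).mp hx)).1
      exact Finset.mem_Iio.mpr ((Finset.mem_Iic.mp hy).trans_lt (Finset.mem_Iio.mp this)))
    (gen k) (isShear_gen k)
  rwa [Finset.sort_toFinset, Finset.sdiff_sdiff_eq_self hA] at this

theorem punctured_inv {k : Fin n} {A : Finset (Fin n)} (hA : A ⊆ Finset.Iio k) :
    (punctured k A)⁻¹ = punctured k A :=
  (isShear_punctured hA).inv_eq (dependsOn_mono_Iio hA)

theorem erase_union_subset_Iio {j k : Fin n} {A B : Finset (Fin n)} (hA : A ⊆ Finset.Iio k)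
    (hB : B ⊆ Finset.Iio j) (hjk : j < k) : A.erase j ∪ B ⊆ Finset.Iio k :=
  Finset.union_subset ((Finset.erase_subset _ _).trans hA)
    (hB.trans (Finset.Iio_subset_Iio hjk.le))

theorem commutator_punctured_of_mem {j k : Fin n} {A B : Finset (Fin n)} (hA : A ⊆ Finset.Iio k)
    (hB : B ⊆ Finset.Iio j) (hj : j ∈ A) :
    ⁅punctured k A, punctured j B⁆ = punctured k (A.erase j ∪ B) := by
  have hjk : j < k := Finset.mem_Iio.mp (hA hj)
  have h := (isShear_punctured hA).commutator hjk (dependsOn_mono_Iio hA) (dependsOn_mono_Iio hB)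
    (isShear_punctured hB)
  rw [partialDeriv_mono, if_pos hj, mono_mul_mono, Finset.union_comm] at h
  exact h.eq (isShear_punctured (erase_union_subset_Iio hA hB hjk))

theorem commutator_punctured_of_mem' {j k : Fin n} {A B : Finset (Fin n)}
    (hA : A ⊆ Finset.Iio k) (hB : B ⊆ Finset.Iio j) (hk : k ∈ B) :
    ⁅punctured k A, punctured j B⁆ = punctured j (B.erase k ∪ A) := by
  rw [← commutatorElement_inv, commutator_punctured_of_mem hB hA hk, punctured_inv]
  exact erase_union_subset_Iio hB hA (Finset.mem_Iio.mp (hB hk))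

theorem commutator_punctured_of_notMem {j k : Fin n} {A B : Finset (Fin n)}
    (hA : A ⊆ Finset.Iio k) (hB : B ⊆ Finset.Iio j) (hj : j ∉ A) (hk : k ∉ B) :
    ⁅punctured k A, punctured j B⁆ = 1 := by
  have key : ∀ {j k : Fin n} {A B : Finset (Fin n)}, A ⊆ Finset.Iio k → B ⊆ Finset.Iio j →
      j ∉ A → j < k → ⁅punctured k A, punctured j B⁆ = 1 := by
    intro j k A B hA hB hj hjk
    have h := (isShear_punctured hA).commutator hjk (dependsOn_mono_Iio hA)
      (dependsOn_mono_Iio hB) (isShear_punctured hB)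
    rw [partialDeriv_mono, if_neg hj, mul_zero] at h
    exact h.eq (isShear_one k)
  rcases lt_trichotomy j k with h | rfl | h
  · exact key hA hB hj h
  · rw [commutatorElement_eq_one_iff_mul_comm]
    have h1 := (isShear_punctured hA).mul (dependsOn_mono_Iio hA) (isShear_punctured hB)
    have h2 := (isShear_punctured hB).mul (dependsOn_mono_Iio hB) (isShear_punctured hA)
    rw [add_comm] at h2
    exact h1.eq h2
  · rw [← commutatorElement_inv, key hB hA hk h, inv_one]

/-! ### Triangular permutations -/

/-- The amount by which `g` changes the letter `k` of a word. -/
def component (k : Fin n) (g : Equiv.Perm (Word n)) (w : Word n) : ZMod 2 := g w k + w k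

theorem apply_eq_add_component (g : Equiv.Perm (Word n)) (w : Word n) (k : Fin n) :
    g w k = w k + component k g w := by
  rw [component, add_comm, add_assoc, CharTwo.add_self_eq_zero, add_zero]

theorem component_mul (k : Fin n) (g h : Equiv.Perm (Word n)) (w : Word n) :
    component k (g * h) w = component k g (h w) + component k h w := by
  have : ∀ a b c : ZMod 2, a + b = a + c + (c + b) := by decide
  exact this _ _ _

theorem component_one (k : Fin n) : component k (1 : Equiv.Perm (Word n)) = 0 := by
  funext w
  exact CharTwo.add_self_eq_zero _

theorem IsShear.component_self {g : Equiv.Perm (Word n)} {k : Fin n} {u : Word n → ZMod 2}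
    (hg : IsShear g k u) : component k g = u := by
  funext w
  rw [component, hg w, Pi.add_apply, Pi.single_eq_same, add_right_comm,
    CharTwo.add_self_eq_zero, zero_add]

theorem IsShear.component_of_ne {g : Equiv.Perm (Word n)} {k : Fin n} {u : Word n → ZMod 2}
    (hg : IsShear g k u) {j : Fin n} (hj : j ≠ k) : component j g = 0 := by
  funext w
  rw [component, hg w, Pi.add_apply, Pi.single_eq_of_ne hj, add_zero,
    CharTwo.add_self_eq_zero]
  rfl

theorem eq_of_component_eq {g h : Equiv.Perm (Word n)}
    (hgh : ∀ k, component k g = component k h) : g = h :=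
  Equiv.ext fun w => funext fun k => by
    rw [apply_eq_add_component, apply_eq_add_component, hgh]

/-- The group of the permutations that change each letter by a function of the earlier letters. -/
def triangular (n : ℕ) : Subgroup (Equiv.Perm (Word n)) where
  carrier := {g | ∀ k, DependsOn (component k g) (Set.Iio k)}
  one_mem' k := by
    rw [component_one]
    exact fun _ _ _ => rfl
  mul_mem' {g h} hg hh k v w hvw := by
    rw [component_mul, component_mul, hh k hvw]
    congr 1
    refine hg k fun i hi => ?_
    rw [apply_eq_add_component, apply_eq_add_component h, hvw i hi,
      hh i fun j hj => hvw j (Set.mem_Iio.mpr (lt_trans hj hi))]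
  inv_mem' {g} hg k v w hvw := by
    have hinv : ∀ x, g (g⁻¹ x) = x := g.apply_symm_apply
    have key : ∀ i < k, g⁻¹ v i = g⁻¹ w i := by
      intro i
      induction i using WellFoundedLT.induction with
      | ind i ih =>
        intro hi
        have h1 := apply_eq_add_component g (g⁻¹ v) i
        have h2 := apply_eq_add_component g (g⁻¹ w) i
        rw [hg i fun j hj => ih j hj (lt_trans hj hi)] at h1
        rw [hinv] at h1 h2
        rw [hvw i hi] at h1
        exact add_right_cancel (h1.symm.trans h2)
    have h := hg k key
    simp only [component, hinv] at h ⊢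
    rw [add_comm, h, add_comm]

theorem mem_triangular {g : Equiv.Perm (Word n)} :
    g ∈ triangular n ↔ ∀ k, DependsOn (component k g) (Set.Iio k) := Iff.rfl

theorem apply_eq_of_forall_lt {g : Equiv.Perm (Word n)} (hg : g ∈ triangular n) {k : Fin n}
    {v w : Word n} (h : ∀ i < k, v i = w i) : ∀ i < k, g v i = g w i := fun i hi => by
  rw [apply_eq_add_component, apply_eq_add_component g w, h i hi,
    hg i fun j hj => h j (lt_trans hj hi)]

/-- Functions of the earlier letters, one for each letter, are the components of a permutation. -/
theorem exists_perm_component {u : Fin n → Word n → ZMod 2}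
    (hu : ∀ k, DependsOn (u k) (Set.Iio k)) :
    ∃ g : Equiv.Perm (Word n), ∀ k, component k g = u k := by
  have hinj : Function.Injective fun (w : Word n) k => w k + u k w := by
    intro v w hvw
    funext i
    induction i using WellFoundedLT.induction with
    | ind i ih =>
      have h := congrFun hvw i
      simp only at h
      rw [hu i fun j hj => ih j hj] at h
      exact add_right_cancel h
  refine ⟨Equiv.ofBijective _ (Finite.injective_iff_bijective.mp hinj), fun k => funext fun w => ?_⟩
  change w k + u k w + w k = u k w
  rw [add_right_comm, CharTwo.add_self_eq_zero, zero_add]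

/-- Letters are cleared from the first on: if right multiplication by elements of `K` preserves `N`
and `K` contains the leading component of each element of `N`, then `N ⊆ K`. -/
theorem subset_of_leading_component {N : Set (Equiv.Perm (Word n))}
    {K : Subgroup (Equiv.Perm (Word n))} (hNK : ∀ g ∈ N, ∀ s ∈ K, g * s ∈ N)
    (hN : ∀ g ∈ N, g ∈ triangular n)
    (hK : ∀ g ∈ N, ∀ m, (∀ j < m, component j g = 0) → ∃ s ∈ K, IsShear s m (component m g)) :
    ∀ g ∈ N, g ∈ K := by
  suffices h : ∀ d ≤ n, ∀ g ∈ N, (∀ j : Fin n, (j : ℕ) < n - d → component j g = 0) → g ∈ K from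
    fun g hg => h n le_rfl g hg fun j hj => by omega
  intro d
  induction d with
  | zero =>
    intro _ g _ h0
    have : g = 1 := eq_of_component_eq fun k => by
      rw [h0 k (by simp), component_one]
    rw [this]
    exact one_mem K
  | succ d ih =>
    intro hd g hg h0
    set m : Fin n := ⟨n - (d + 1), by omega⟩ with hm
    have hlt : ∀ j < m, component j g = 0 := fun j hj => h0 j hj
    obtain ⟨s, hsK, hs⟩ := hK g hg m hlt
    have hgs : g * s ∈ K := by
      refine ih (by omega) _ (hNK g hg s hsK) fun j hj => ?_
      funext w
      rw [component_mul]
      rcases lt_or_eq_of_le (show j ≤ m from Fin.le_def.mpr (by simp only [hm]; omega))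
        with hjm | rfl
      · rw [hlt j hjm, hs.component_of_ne hjm.ne]
        exact add_zero _
      · rw [hs.component_self, hs w, apply_add_single_of_dependsOn (hN g hg _) le_rfl,
          CharTwo.add_self_eq_zero]
        rfl
    simpa using mul_mem hgs (inv_mem hsK)

/-! ### Closed families of monomials and their groups -/

/-- A family `H` of sets of monomials, one for each letter, such that the rigid commutators based
at `k` and punctured at the members of `H k` form a saturated set. -/
structure IsClosedFamily (H : Fin n → Set (Finset (Fin n))) : Prop where
  subset_Iio : ∀ {k A}, A ∈ H k → A ⊆ Finset.Iio k
  erase_union_mem : ∀ {k A j B}, A ∈ H k → j ∈ A → B ∈ H j → A.erase j ∪ B ∈ H k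

/-- The rigid commutators of a family. -/
def familyRigid (H : Fin n → Set (Finset (Fin n))) : Set (Equiv.Perm (Word n)) :=
  {g | ∃ k, ∃ A ∈ H k, g = punctured k A}

theorem IsClosedFamily.commutator_mem {H : Fin n → Set (Finset (Fin n))} (hH : IsClosedFamily H)
    {g h : Equiv.Perm (Word n)} (hg : g ∈ familyRigid H) (hh : h ∈ familyRigid H) :
    ⁅g, h⁆ ∈ insert 1 (familyRigid H) := by
  obtain ⟨k, A, hA, rfl⟩ := hg
  obtain ⟨j, B, hB, rfl⟩ := hh
  have hA' := hH.subset_Iio hA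
  have hB' := hH.subset_Iio hB
  by_cases hj : j ∈ A
  · exact Or.inr ⟨k, _, hH.erase_union_mem hA hj hB, commutator_punctured_of_mem hA' hB' hj⟩
  by_cases hk : k ∈ B
  · exact Or.inr ⟨j, _, hH.erase_union_mem hB hk hA, commutator_punctured_of_mem' hA' hB' hk⟩
  exact Or.inl (commutator_punctured_of_notMem hA' hB' hj hk)

theorem IsClosedFamily.dependsOn {H : Fin n → Set (Finset (Fin n))} (hH : IsClosedFamily H)
    {k : Fin n} {u : Word n → ZMod 2} (hu : u ∈ monoSpan (H k)) : DependsOn u (Set.Iio k) :=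
  dependsOn_of_mem_monoSpan (fun _ hA _ hi => Finset.mem_Iio.mp (hH.subset_Iio hA hi)) hu

theorem IsClosedFamily.exists_isShear {H : Fin n → Set (Finset (Fin n))} (hH : IsClosedFamily H)
    {k : Fin n} {u : Word n → ZMod 2} (hu : u ∈ monoSpan (H k)) :
    ∃ s ∈ Subgroup.closure (familyRigid H), IsShear s k u := by
  induction hu using Submodule.span_induction with
  | mem x hx =>
    obtain ⟨A, hA, rfl⟩ := hx
    exact ⟨punctured k A, Subgroup.subset_closure ⟨k, A, hA, rfl⟩,
      isShear_punctured (hH.subset_Iio hA)⟩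
  | zero => exact ⟨1, one_mem _, isShear_one k⟩
  | add x y hx _ ihx ihy =>
    obtain ⟨s, hs, hsx⟩ := ihx
    obtain ⟨t, ht, hty⟩ := ihy
    exact ⟨s * t, mul_mem hs ht, hsx.mul (hH.dependsOn hx) hty⟩
  | smul a x _ ih =>
    have ha : a = 0 ∨ a = 1 := by revert a; decide
    rcases ha with rfl | rfl
    · exact ⟨1, one_mem _, by simpa using isShear_one k⟩
    · simpa using ih

theorem IsClosedFamily.comp_punctured_mem {H : Fin n → Set (Finset (Fin n))}
    (hH : IsClosedFamily H) {k : Fin n} {A : Finset (Fin n)} (hA : A ∈ H k) {j : Fin n}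
    {u : Word n → ZMod 2} (hu : u ∈ monoSpan (H j)) :
    (fun w => u (punctured k A w)) ∈ monoSpan (H j) := by
  have h : (fun w => u (punctured k A w)) = u + mono A * partialDeriv k u := by
    funext w
    rw [isShear_punctured (hH.subset_Iio hA) w, apply_add_single u]
    rfl
  rw [h]
  refine add_mem hu ?_
  clear h
  induction hu using Submodule.span_induction with
  | mem x hx =>
    obtain ⟨B, hB, rfl⟩ := hx
    rw [partialDeriv_mono]
    split_ifs with hk
    · rw [mono_mul_mono, mono_mem_monoSpan, Finset.union_comm]
      exact hH.erase_union_mem hB hk hA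
    · simp
  | zero => simp
  | add x y _ _ hx hy =>
    rw [map_add, mul_add]
    exact add_mem hx hy
  | smul a x _ hx =>
    rw [map_smul, mul_smul_comm]
    exact Submodule.smul_mem _ _ hx

theorem IsClosedFamily.component_mul_punctured_mem {H : Fin n → Set (Finset (Fin n))}
    (hH : IsClosedFamily H) {g s : Equiv.Perm (Word n)}
    (hg : ∀ k, component k g ∈ monoSpan (H k)) (hs : s ∈ familyRigid H) (k : Fin n) :
    component k (g * s) ∈ monoSpan (H k) := by
  obtain ⟨j, A, hA, rfl⟩ := hs
  have h : component k (g * punctured j A) =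
      (fun w => component k g (punctured j A w)) + component k (punctured j A) :=
    funext fun w => component_mul k g _ w
  rw [h]
  refine add_mem (hH.comp_punctured_mem hA (hg k)) ?_
  have hsh := isShear_punctured (hH.subset_Iio hA)
  rcases eq_or_ne k j with rfl | hkj
  · rw [hsh.component_self, mono_mem_monoSpan]
    exact hA
  · rw [hsh.component_of_ne hkj]
    exact zero_mem _

theorem IsClosedFamily.component_mul_mem {H : Fin n → Set (Finset (Fin n))}
    (hH : IsClosedFamily H) {g s : Equiv.Perm (Word n)}
    (hg : ∀ k, component k g ∈ monoSpan (H k)) (hs : s ∈ Subgroup.closure (familyRigid H)) :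
    ∀ k, component k (g * s) ∈ monoSpan (H k) := by
  induction hs using Subgroup.closure_induction_right with
  | one => simpa using hg
  | mul_right x _ y hy ih =>
    rw [← mul_assoc]
    exact hH.component_mul_punctured_mem ih hy
  | mul_inv_cancel x _ y hy ih =>
    have hy' : y⁻¹ = y := by
      obtain ⟨j, A, hA, rfl⟩ := hy
      exact punctured_inv (hH.subset_Iio hA)
    rw [← mul_assoc, hy']
    exact hH.component_mul_punctured_mem ih hy

/-- The group of a closed family consists of the permutations whose components are combinations of
the monomials in the family. -/
theorem IsClosedFamily.mem_closure_iff {H : Fin n → Set (Finset (Fin n))}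
    (hH : IsClosedFamily H) {g : Equiv.Perm (Word n)} :
    g ∈ Subgroup.closure (familyRigid H) ↔ ∀ k, component k g ∈ monoSpan (H k) := by
  constructor
  · intro hg
    rw [← one_mul g]
    refine hH.component_mul_mem (fun k => ?_) hg
    rw [component_one]
    exact zero_mem _
  · intro hg
    exact subset_of_leading_component (N := {g | ∀ k, component k g ∈ monoSpan (H k)})
      (fun g hg s hs => hH.component_mul_mem hg hs)
      (fun g hg k => hH.dependsOn (hg k)) (fun g hg m _ => hH.exists_isShear (hg m)) g hg

theorem IsClosedFamily.closure_le_triangular {H : Fin n → Set (Finset (Fin n))}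
    (hH : IsClosedFamily H) : Subgroup.closure (familyRigid H) ≤ triangular n :=
  fun _ hg k => hH.dependsOn (hH.mem_closure_iff.mp hg k)

theorem IsClosedFamily.punctured_mem_closure_iff {H : Fin n → Set (Finset (Fin n))}
    (hH : IsClosedFamily H) {k : Fin n} {A : Finset (Fin n)} (hA : A ⊆ Finset.Iio k) :
    punctured k A ∈ Subgroup.closure (familyRigid H) ↔ A ∈ H k := by
  refine ⟨fun h => ?_, fun h => Subgroup.subset_closure ⟨k, A, h, rfl⟩⟩
  have := hH.mem_closure_iff.mp h k
  rwa [(isShear_punctured hA).component_self, mono_mem_monoSpan] at this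

theorem IsClosedFamily.card_closure {H : Fin n → Set (Finset (Fin n))}
    (hH : IsClosedFamily H) :
    Nat.card (Subgroup.closure (familyRigid H)) = 2 ^ ∑ k, (H k).ncard := by
  let φ : Subgroup.closure (familyRigid H) → ∀ k, monoSpan (H k) :=
    fun g k => ⟨component k g, hH.mem_closure_iff.mp g.2 k⟩
  have hφ : Function.Bijective φ := by
    constructor
    · intro g h hgh
      exact Subtype.ext (eq_of_component_eq fun k => congrArg Subtype.val (congrFun hgh k))
    · intro u
      obtain ⟨g, hg⟩ := exists_perm_component fun k => hH.dependsOn (u k).2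
      refine ⟨⟨g, hH.mem_closure_iff.mpr fun k => ?_⟩, funext fun k => Subtype.ext (hg k)⟩
      rw [hg]
      exact (u k).2
  rw [Nat.card_congr (Equiv.ofBijective φ hφ), Nat.card_pi, ← Finset.prod_pow_eq_pow_sum]
  refine Finset.prod_congr rfl fun k _ => ?_
  rw [Module.natCard_eq_pow_finrank (K := ZMod 2), finrank_monoSpan, Nat.card_zmod]

/-- The family of all monomials in the letters before the given one. -/
def fullFamily (n : ℕ) (k : Fin n) : Set (Finset (Fin n)) := {A | A ⊆ Finset.Iio k}

theorem isClosedFamily_full : IsClosedFamily (fullFamily n) where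
  subset_Iio h := h
  erase_union_mem hA hj hB := erase_union_subset_Iio hA hB (Finset.mem_Iio.mp (hA hj))

theorem mem_monoSpan_fullFamily {k : Fin n} {u : Word n → ZMod 2} :
    u ∈ monoSpan (fullFamily n k) ↔ DependsOn u (Set.Iio k) := by
  refine ⟨isClosedFamily_full.dependsOn, fun hu => mem_monoSpan.mpr fun A hA i hi => ?_⟩
  exact Finset.mem_Iio.mpr (subset_of_coef_ne_zero hu hA hi)

theorem closure_fullFamily : Subgroup.closure (familyRigid (fullFamily n)) = triangular n := by
  ext g
  rw [isClosedFamily_full.mem_closure_iff, mem_triangular]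
  exact forall_congr' fun k => mem_monoSpan_fullFamily

theorem leftNormed_mem {G : Type*} [Group G] (K : Subgroup G) (l : List G) (hl : ∀ g ∈ l, g ∈ K) :
    leftNormed l ∈ K := by
  cases l with
  | nil => exact one_mem K
  | cons g l =>
    rw [leftNormed]
    have hg : g ∈ K := hl g (by simp)
    have hl' : ∀ x ∈ l, x ∈ K := fun x hx => hl x (by simp [hx])
    clear hl
    induction l generalizing g with
    | nil => exact hg
    | cons x l ih =>
      have hx := hl' x (by simp)
      refine ih ⁅g, x⁆ ?_ fun y hy => hl' y (by simp [hy])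
      rw [commutatorElement_def]
      exact mul_mem (mul_mem (mul_mem hg hx) (inv_mem hg)) (inv_mem hx)

theorem stdSylow_eq_triangular : stdSylow n = triangular n := by
  apply le_antisymm
  · rw [stdSylow, ← closure_fullFamily, Subgroup.closure_le]
    rintro _ ⟨i, rfl⟩
    refine Subgroup.subset_closure ⟨i, Finset.Iio i, subset_refl (Finset.Iio i), ?_⟩
    exact (isShear_gen i).eq (isShear_punctured subset_rfl)
  · rw [← closure_fullFamily, Subgroup.closure_le]
    rintro _ ⟨k, A, _, rfl⟩
    refine leftNormed_mem _ _ fun g hg => ?_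
    obtain ⟨i, _, rfl⟩ := List.mem_map.mp hg
    exact Subgroup.subset_closure ⟨i, rfl⟩

/-- The family containing only the monomial `1` for each letter. -/
def constFamily (n : ℕ) (_ : Fin n) : Set (Finset (Fin n)) := {∅}

theorem isClosedFamily_const : IsClosedFamily (constFamily n) where
  subset_Iio h := by rw [Set.mem_singleton_iff.mp h]; exact Finset.empty_subset _
  erase_union_mem hA hj _ := by rw [Set.mem_singleton_iff.mp hA] at hj; simp at hj

theorem stdT_eq_closure : stdT n = Subgroup.closure (familyRigid (constFamily n)) := by
  rw [stdT]
  congr 1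
  ext g
  simp [familyRigid, constFamily, eq_comm]

theorem mem_stdT {g : Equiv.Perm (Word n)} : g ∈ stdT n ↔ ∃ u, ∀ w, g w = w + u := by
  rw [stdT_eq_closure, isClosedFamily_const.mem_closure_iff]
  have h1 : ∀ u : Word n → ZMod 2, u ∈ monoSpan {∅} ↔ ∃ a : ZMod 2, ∀ w, u w = a := fun u => by
    rw [monoSpan, Set.image_singleton, mono_empty, Submodule.mem_span_singleton]
    exact exists_congr fun a => by simp [funext_iff, eq_comm]
  simp only [constFamily, h1]
  constructor
  · intro h
    choose u hu using h
    exact ⟨u, fun w => funext fun k => by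
      rw [apply_eq_add_component, hu, Pi.add_apply]⟩
  · rintro ⟨u, hu⟩ k
    refine ⟨u k, fun w => ?_⟩
    rw [component, hu, Pi.add_apply, add_right_comm, CharTwo.add_self_eq_zero, zero_add]

/-! ### Normalizers of closed families -/

/-- The family of all rigid commutators whose commutators with the members of `H` are trivial or
belong to `H`. -/
def normalizerFamily (H : Fin n → Set (Finset (Fin n))) (k : Fin n) : Set (Finset (Fin n)) :=
  {A | A ⊆ Finset.Iio k ∧ ∀ j, ∀ B ∈ H j,
    (j ∈ A → A.erase j ∪ B ∈ H k) ∧ (k ∈ B → B.erase k ∪ A ∈ H j)}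

theorem IsClosedFamily.mem_of_subset {H : Fin n → Set (Finset (Fin n))} (hH : IsClosedFamily H)
    (h0 : ∀ k, ∅ ∈ H k) {k : Fin n} {A B : Finset (Fin n)} (hA : A ∈ H k) (hBA : B ⊆ A) :
    B ∈ H k := by
  have key : ∀ C : Finset (Fin n), A \ C ∈ H k := by
    intro C
    induction C using Finset.induction_on with
    | empty => simpa using hA
    | insert i C _ ih =>
      rw [Finset.sdiff_insert]
      by_cases hi : i ∈ A \ C
      · simpa using hH.erase_union_mem ih hi (h0 i)
      · rwa [Finset.erase_eq_of_notMem hi]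
  simpa [Finset.sdiff_sdiff_eq_self hBA] using key (A \ B)

theorem IsClosedFamily.le_normalizerFamily {H : Fin n → Set (Finset (Fin n))}
    (hH : IsClosedFamily H) (k : Fin n) : H k ⊆ normalizerFamily H k := fun _ hA =>
  ⟨hH.subset_Iio hA, fun _ _ hB =>
    ⟨fun hj => hH.erase_union_mem hA hj hB, fun hk => hH.erase_union_mem hB hk hA⟩⟩

theorem IsClosedFamily.punctured_mem_normalizer {H : Fin n → Set (Finset (Fin n))}
    (hH : IsClosedFamily H) {k : Fin n} {A : Finset (Fin n)} (hA : A ∈ normalizerFamily H k) :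
    punctured k A ∈ Subgroup.normalizer (Subgroup.closure (familyRigid H) : Set _) := by
  have key : ∀ h ∈ Subgroup.closure (familyRigid H),
      punctured k A * h * (punctured k A)⁻¹ ∈ Subgroup.closure (familyRigid H) := by
    intro h hh
    induction hh using Subgroup.closure_induction with
    | mem x hx =>
      rw [← inv_mul_cancel_right (punctured k A * x * (punctured k A)⁻¹) x,
        ← commutatorElement_def]
      refine mul_mem ?_ (Subgroup.subset_closure hx)
      obtain ⟨j, B, hB, rfl⟩ := hx
      have hB' := hH.subset_Iio hB
      by_cases hj : j ∈ A
      · rw [commutator_punctured_of_mem hA.1 hB' hj]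
        exact Subgroup.subset_closure ⟨k, _, (hA.2 j B hB).1 hj, rfl⟩
      by_cases hk : k ∈ B
      · rw [commutator_punctured_of_mem' hA.1 hB' hk]
        exact Subgroup.subset_closure ⟨j, _, (hA.2 j B hB).2 hk, rfl⟩
      rw [commutator_punctured_of_notMem hA.1 hB' hj hk]
      exact one_mem _
    | one => simp
    | mul x y _ _ hx hy =>
      rw [← conj_mul]
      exact mul_mem hx hy
    | inv x _ hx =>
      rw [← conj_inv]
      exact inv_mem hx
  rw [Subgroup.mem_normalizer_iff]
  refine fun h => ⟨key h, fun hh => ?_⟩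
  have := key _ hh
  rwa [punctured_inv hA.1, ← mul_assoc, ← mul_assoc, ← sq, mul_assoc, ← sq, sq,
    mul_eq_one_iff_inv_eq.mpr (punctured_inv hA.1), one_mul, mul_one] at this

/-- In the expansion of `y_D ∘ g`, where `y_D` is the monomial of `D`, only one term contains all
letters of `D`, since `g` changes each letter by a function of the earlier ones. -/
theorem coef_mono_comp_mul {g : Equiv.Perm (Word n)} (hg : g ∈ triangular n) {m : Fin n}
    {q : Word n → ZMod 2} (hq : DependsOn q (Set.Iic m)) (D : Finset (Fin n))
    (hD : ∀ d ∈ D, m < d) {C : Finset (Fin n)} (hDC : D ⊆ C) :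
    coef C ((fun w => mono D (g w)) * q) = coef (C \ D) q := by
  induction D using Finset.induction_on_max generalizing C with
  | empty => simp only [mono_empty, Finset.sdiff_empty]; congr 1; exact one_mul q
  | insert d D hd ih =>
    set F : Word n → ZMod 2 := (fun w => mono D (g w)) * q with hF
    have hFd : DependsOn F (Set.Iio d) := by
      intro v w hvw
      simp only [hF, Pi.mul_apply]
      congr 1
      · exact dependsOn_mono D fun i hi =>
          apply_eq_of_forall_lt hg (fun j hj => hvw j hj) i (hd i hi)
      · exact hq fun i hi => hvw i (lt_of_le_of_lt hi (hD d (Finset.mem_insert_self d D)))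
    have hgF : DependsOn (component d g * F) (Set.Iio d) := fun v w hvw => by
      rw [Pi.mul_apply, Pi.mul_apply, hg d hvw, hFd hvw]
    have hprod : (fun w => mono (insert d D) (g w)) * q = mono {d} * F + component d g * F := by
      funext w
      simp only [Finset.insert_eq, ← mono_mul_mono, Pi.mul_apply, Pi.add_apply, hF,
        mono_singleton_apply, apply_eq_add_component g w d]
      ring
    have hdC : d ∈ C := hDC (Finset.mem_insert_self d D)
    rw [hprod, ← Finset.insert_erase hdC, ← coef_partialDeriv (Finset.notMem_erase d C), map_add,
      partialDeriv_mono_singleton_mul hFd (by simp), partialDeriv_eq_zero hgF (by simp), add_zero,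
      ih (fun i hi => hD i (Finset.mem_insert_of_mem hi))
        fun i hi => Finset.mem_erase.mpr ⟨(hd i hi).ne, hDC (Finset.mem_insert_of_mem hi)⟩]
    rw [Finset.insert_erase hdC, Finset.sdiff_insert, Finset.erase_sdiff_comm]

theorem IsClosedFamily.conj_mem {H : Fin n → Set (Finset (Fin n))} {g h : Equiv.Perm (Word n)}
    (hg : g ∈ Subgroup.normalizer (Subgroup.closure (familyRigid H) : Set _))
    (hh : h ∈ familyRigid H) : ∃ h' ∈ Subgroup.closure (familyRigid H), g * h = h' * g :=
  ⟨g * h * g⁻¹, (Subgroup.mem_normalizer_iff.mp hg h).mp (Subgroup.subset_closure hh), by simp⟩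

/-- An element normalizing the group of a closed family acts on the spaces of components by
substitution. -/
theorem IsClosedFamily.mono_comp_mem {H : Fin n → Set (Finset (Fin n))} (hH : IsClosedFamily H)
    {g : Equiv.Perm (Word n)} (hgU : g ∈ triangular n)
    (hg : g ∈ Subgroup.normalizer (Subgroup.closure (familyRigid H) : Set _))
    {j : Fin n} {B : Finset (Fin n)} (hB : B ∈ H j) :
    (fun w => mono B (g w)) ∈ monoSpan (H j) := by
  obtain ⟨h', hh', he⟩ := IsClosedFamily.conj_mem (inv_mem hg) ⟨j, B, hB, rfl⟩
  convert hH.mem_closure_iff.mp hh' j using 1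
  funext w
  have h1 := component_mul j g⁻¹ (punctured j B) (g w)
  have hsh := isShear_punctured (hH.subset_Iio hB)
  rw [he, component_mul, hsh.component_self, hsh (g w),
    apply_add_single_of_dependsOn (inv_mem hgU j) le_rfl, add_comm] at h1
  have h2 : g⁻¹ (g w) = w := g.symm_apply_apply w
  rw [h2] at h1
  exact (add_left_cancel h1).symm

/-- The leading component of an element of the normalizer is a combination of monomials that
individually normalize. -/
theorem IsClosedFamily.leading_component_mem {H : Fin n → Set (Finset (Fin n))}
    (hH : IsClosedFamily H) (h0 : ∀ k, ∅ ∈ H k) {g : Equiv.Perm (Word n)}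
    (hgU : g ∈ triangular n)
    (hg : g ∈ Subgroup.normalizer (Subgroup.closure (familyRigid H) : Set _))
    {m : Fin n} (hm : ∀ j < m, component j g = 0) :
    component m g ∈ monoSpan (normalizerFamily H m) := by
  rw [mem_monoSpan]
  intro A hA
  have hAm : A ⊆ Finset.Iio m := fun i hi =>
    Finset.mem_Iio.mpr (subset_of_coef_ne_zero (hgU m) hA hi)
  have hfix : ∀ w, ∀ i < m, g w i = w i := fun w i hi => by
    rw [apply_eq_add_component, hm i hi]; exact add_zero _
  refine ⟨hAm, fun j B hB => ⟨fun hj => ?_, fun hmB => ?_⟩⟩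
  · have hjm : j < m := Finset.mem_Iio.mp (hAm hj)
    refine union_mem_of_mul_mono_mem (u := partialDeriv j (component m g)) B (fun B' hB' => ?_) ?_
    · have hB'j := hH.mem_of_subset h0 hB hB'
      obtain ⟨h', hh', he⟩ := IsClosedFamily.conj_mem hg ⟨j, B', hB'j, rfl⟩
      convert hH.mem_closure_iff.mp hh' m using 1
      funext w
      have h1 := component_mul m g (punctured j B') w
      have hsh := isShear_punctured (hH.subset_Iio hB'j)
      have h2 : component m h' (g w) = component m h' w :=
        hH.dependsOn (hH.mem_closure_iff.mp hh' m) fun i hi => hfix w i hi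
      rw [he, component_mul, hsh.component_of_ne hjm.ne', hsh w,
        apply_add_single (component m g), h2, Pi.zero_apply, add_zero, add_comm] at h1
      rw [Pi.mul_apply, mul_comm]
      exact (add_left_cancel h1).symm
    · rwa [coef_partialDeriv (Finset.notMem_erase j A), Finset.insert_erase hj]
  · have hBj := hH.subset_Iio hB
    set D := B.filter fun i => m < i with hD
    set E := B.filter fun i => i < m with hE
    have hDm : ∀ d ∈ D, m < d := fun d hd => (Finset.mem_filter.mp hd).2
    have hEm : E ⊆ Finset.Iio m := fun i hi => Finset.mem_Iio.mpr (Finset.mem_filter.mp hi).2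
    have hmem : A ∪ E ∈ {F | D ∪ F ∈ H j} := by
      refine union_mem_of_mul_mono_mem E (fun E' hE' => mem_monoSpan.mpr fun F hF => ?_) hA
      have hE'm := hE'.trans hEm
      have hgE : DependsOn (component m g * mono E') (Set.Iio m) := fun v w hvw => by
        rw [Pi.mul_apply, Pi.mul_apply, hgU m hvw, dependsOn_mono_Iio hE'm hvw]
      have hFm : ∀ i ∈ F, i < m := fun i hi => subset_of_coef_ne_zero hgE hF hi
      have hmF : m ∉ F := fun h => lt_irrefl _ (hFm m h)
      have hmE' : m ∉ E' := fun h => lt_irrefl _ (Finset.mem_Iio.mp (hE'm h))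
      set q := mono (insert m E') + component m g * mono E' with hq
      have hqm : DependsOn q (Set.Iic m) := by
        intro v w hvw
        simp only [hq, Pi.add_apply]
        rw [hgE fun i hi => hvw i (Set.mem_Iic.mpr (le_of_lt hi))]
        congr 1
        refine dependsOn_mono (insert m E') fun i hi => hvw i ?_
        rcases Finset.mem_insert.mp (Finset.mem_coe.mp hi) with rfl | hi'
        · exact Set.mem_Iic.mpr le_rfl
        · exact (Finset.mem_Iio.mp (hE'm hi')).le
      have hsub : D ∪ insert m E' ⊆ B := by
        intro i hi
        rcases Finset.mem_union.mp hi with hi | hi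
        · exact (Finset.mem_filter.mp hi).1
        · rcases Finset.mem_insert.mp hi with rfl | hi
          · exact hmB
          · exact (Finset.mem_filter.mp (hE' hi)).1
      have hspan := hH.mono_comp_mem hgU hg (hH.mem_of_subset h0 hB hsub)
      have hprod : (fun w => mono (D ∪ insert m E') (g w)) = (fun w => mono D (g w)) * q := by
        funext w
        have hE'w : mono E' (g w) = mono E' w :=
          dependsOn_mono_Iio hE'm fun i hi => hfix w i hi
        simp only [← mono_mul_mono, Finset.insert_eq, Pi.mul_apply, Pi.add_apply, hq,
          mono_singleton_apply, apply_eq_add_component g w m, hE'w]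
        ring
      rw [hprod, mem_monoSpan] at hspan
      refine hspan _ ?_
      rw [coef_mono_comp_mul hgU hqm D hDm Finset.subset_union_left, Finset.union_sdiff_left,
        Finset.sdiff_eq_self_of_disjoint, hq, map_add, coef_mono, if_neg, zero_add]
      · exact hF
      · rintro rfl
        exact hmF (Finset.mem_insert_self m E')
      · rw [Finset.disjoint_left]
        exact fun i hi hi' => lt_asymm (hFm i hi) (hDm i hi')
    have : B.erase m ∪ A = D ∪ (A ∪ E) := by
      ext i
      simp only [hD, hE, Finset.mem_union, Finset.mem_erase, Finset.mem_filter]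
      have := lt_trichotomy i m
      grind
    rw [this]
    exact hmem

theorem IsClosedFamily.isClosedFamily_normalizerFamily {H : Fin n → Set (Finset (Fin n))}
    (hH : IsClosedFamily H) (h0 : ∀ k, ∅ ∈ H k) : IsClosedFamily (normalizerFamily H) where
  subset_Iio h := h.1
  erase_union_mem {k A j B} hA hj hB := by
    have hjk : j < k := Finset.mem_Iio.mp (hA.1 hj)
    have hsub := erase_union_subset_Iio hA.1 hB.1 hjk
    have hsh := isShear_punctured hsub
    have hmem : punctured k (A.erase j ∪ B) ∈
        Subgroup.normalizer (Subgroup.closure (familyRigid H) : Set _) := by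
      rw [← commutator_punctured_of_mem hA.1 hB.1 hj, commutatorElement_def]
      have h1 := hH.punctured_mem_normalizer hA
      have h2 := hH.punctured_mem_normalizer hB
      exact mul_mem (mul_mem (mul_mem h1 h2) (inv_mem h1)) (inv_mem h2)
    have hU : punctured k (A.erase j ∪ B) ∈ triangular n := by
      rw [← closure_fullFamily]
      exact Subgroup.subset_closure ⟨k, _, hsub, rfl⟩
    have := hH.leading_component_mem h0 hU hmem fun i hi => hsh.component_of_ne hi.ne
    rwa [hsh.component_self, mono_mem_monoSpan] at this

/-- The normalizer of the group of a closed family is the group of the normalizer family. -/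
theorem IsClosedFamily.normalizer_closure {H : Fin n → Set (Finset (Fin n))}
    (hH : IsClosedFamily H) (h0 : ∀ k, ∅ ∈ H k) :
    triangular n ⊓ Subgroup.normalizer (Subgroup.closure (familyRigid H) : Set _) =
      Subgroup.closure (familyRigid (normalizerFamily H)) := by
  have hH' := hH.isClosedFamily_normalizerFamily h0
  have hle : Subgroup.closure (familyRigid (normalizerFamily H)) ≤
      triangular n ⊓ Subgroup.normalizer (Subgroup.closure (familyRigid H) : Set _) := by
    refine le_inf hH'.closure_le_triangular ?_
    rw [Subgroup.closure_le]
    rintro _ ⟨k, A, hA, rfl⟩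
    exact hH.punctured_mem_normalizer hA
  refine le_antisymm (fun g hg => ?_) hle
  refine subset_of_leading_component
    (N := (triangular n ⊓ Subgroup.normalizer (Subgroup.closure (familyRigid H) : Set _) :
      Subgroup (Equiv.Perm (Word n))))
    (fun g hg s hs => mul_mem hg (hle hs)) (fun g hg => hg.1) (fun g hg m hm => ?_) g hg
  exact hH'.exists_isShear (hH.leading_component_mem h0 hg.1 hg.2 hm)

end RigidComm

namespace PartLie

variable {n : ℕ}

/-! ### The Lie ring in terms of supports -/

theorem BasisElt.mem_supp {b : BasisElt 2 n} {j : Fin n} : j ∈ b.supp ↔ b.expo j = 1 := by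
  have := b.expo_lt j
  simp only [BasisElt.supp, Finset.mem_filter, Finset.mem_univ, true_and]
  omega

theorem BasisElt.notMem_supp {b : BasisElt 2 n} {j : Fin n} : j ∉ b.supp ↔ b.expo j = 0 := by
  simp [BasisElt.supp]

theorem BasisElt.supp_subset (b : BasisElt 2 n) : b.supp ⊆ Finset.Iio b.idx := fun j hj =>
  Finset.mem_Iio.mpr (b.supp_lt j (Finset.mem_filter.mp hj).2)

theorem BasisElt.idx_notMem_supp (b : BasisElt 2 n) : b.idx ∉ b.supp := fun h =>
  lt_irrefl _ (Finset.mem_Iio.mp (b.supp_subset h))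

theorem BasisElt.expo_eq_ite (b : BasisElt 2 n) (j : Fin n) :
    b.expo j = if j ∈ b.supp then 1 else 0 := by
  split_ifs with hj
  · exact mem_supp.mp hj
  · exact notMem_supp.mp hj

theorem BasisElt.ext_supp {a b : BasisElt 2 n} (hi : a.idx = b.idx) (hs : a.supp = b.supp) :
    a = b := by
  refine BasisElt.ext (funext fun j => ?_) hi
  rw [expo_eq_ite, expo_eq_ite, hs]

theorem BasisElt.exists_supp_eq {k : Fin n} {A : Finset (Fin n)} (hA : A ⊆ Finset.Iio k) :
    ∃ b : BasisElt 2 n, b.idx = k ∧ b.supp = A := by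
  refine ⟨⟨fun j => if j ∈ A then 1 else 0, k, fun j => ?_, fun j hj => ?_⟩, rfl, ?_⟩
  · split_ifs <;> omega
  · exact Finset.mem_Iio.mp (hA (by simpa using hj))
  · ext j
    simp [BasisElt.supp]

theorem BasisElt.toLie_apply_self (b : BasisElt 2 n) : b.toLie b = 1 := by
  simp [BasisElt.toLie]

theorem BasisElt.eq_of_toLie_eq_smul {b c : BasisElt 2 n} {a : ZMod 2}
    (h : b.toLie = a • c.toLie) : b = c := by
  by_contra hbc
  have := DFunLike.congr_fun h b
  simp [BasisElt.toLie, Ne.symm hbc] at this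

theorem bracket_toLie (a b : BasisElt 2 n) :
    bracket 2 n a.toLie b.toLie = basisBracket a b := by
  simp [bracket, BasisElt.toLie]

theorem basisBracket_comm (a b : BasisElt 2 n) : basisBracket a b = basisBracket b a := by
  have hneg : ∀ x : LieRingOfPartitions 2 n, -x = x := fun x =>
    Finsupp.ext fun c => by rw [Finsupp.neg_apply]; exact ZModModule.neg_eq_self _
  unfold basisBracket
  rcases lt_trichotomy a.idx b.idx with h | h | h
  · rw [if_neg h.not_gt, if_pos h, if_pos h, hneg, add_comm]
  · simp [h]
  · rw [if_pos h, if_neg h.not_gt, if_pos h, hneg, add_comm]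

theorem basisBracket_of_mem {a b : BasisElt 2 n} (h : b.idx ∈ a.supp)
    (hd : Disjoint (a.supp.erase b.idx) b.supp) :
    ∃ c : BasisElt 2 n, c.idx = a.idx ∧ c.supp = a.supp.erase b.idx ∪ b.supp ∧
      basisBracket a b = c.toLie := by
  have hlt : b.idx < a.idx := Finset.mem_Iio.mp (a.supp_subset h)
  have hsub := RigidComm.erase_union_subset_Iio a.supp_subset b.supp_subset hlt
  obtain ⟨c, hck, hcs⟩ := BasisElt.exists_supp_eq hsub
  refine ⟨c, hck, hcs, ?_⟩
  have hexpo : a.expo - Pi.single b.idx 1 + b.expo = c.expo := by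
    funext j
    have hdj : j ∈ a.supp.erase b.idx → j ∉ b.supp := fun h h' =>
      Finset.disjoint_left.mp hd h h'
    have hb := b.idx_notMem_supp
    simp only [Pi.add_apply, Pi.sub_apply, Pi.single_apply, BasisElt.expo_eq_ite, hcs]
    grind
  rw [basisBracket, if_pos hlt, BasisElt.mem_supp.mp h, hexpo, Nat.cast_one, one_smul,
    ← hck, monomialDer, dif_pos ⟨c.expo_lt, c.supp_lt⟩]

theorem basisBracket_of_not_disjoint {a b : BasisElt 2 n} (h : b.idx ∈ a.supp)
    (hd : ¬ Disjoint (a.supp.erase b.idx) b.supp) : basisBracket a b = 0 := by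
  have hlt : b.idx < a.idx := Finset.mem_Iio.mp (a.supp_subset h)
  rw [basisBracket, if_pos hlt, monomialDer, dif_neg, smul_zero]
  rintro ⟨h2, -⟩
  obtain ⟨j, hja, hjb⟩ := Finset.not_disjoint_iff.mp hd
  have h3 := h2 j
  rw [Finset.mem_erase] at hja
  rw [Pi.add_apply, Pi.sub_apply, Pi.single_eq_of_ne hja.1, BasisElt.mem_supp.mp hja.2,
    BasisElt.mem_supp.mp hjb] at h3
  omega

theorem basisBracket_of_notMem {a b : BasisElt 2 n} (h : b.idx ∉ a.supp) (h' : a.idx ∉ b.supp) :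
    basisBracket a b = 0 := by
  unfold basisBracket
  rw [BasisElt.notMem_supp.mp h, BasisElt.notMem_supp.mp h']
  simp

/-- The bracket of `a` and `b` is the basis element `c`, and it arises by differentiating the monomial
of `a`. -/
def IsLeftBracket (a b c : BasisElt 2 n) : Prop :=
  b.idx ∈ a.supp ∧ Disjoint (a.supp.erase b.idx) b.supp ∧
    c.idx = a.idx ∧ c.supp = a.supp.erase b.idx ∪ b.supp

theorem basisBracket_eq_zero_or (a b : BasisElt 2 n) :
    basisBracket a b = 0 ∨
      ∃ c, basisBracket a b = c.toLie ∧ (IsLeftBracket a b c ∨ IsLeftBracket b a c) := by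
  by_cases h : b.idx ∈ a.supp
  · by_cases hd : Disjoint (a.supp.erase b.idx) b.supp
    · obtain ⟨c, h1, h2, h3⟩ := basisBracket_of_mem h hd
      exact Or.inr ⟨c, h3, Or.inl ⟨h, hd, h1, h2⟩⟩
    · exact Or.inl (basisBracket_of_not_disjoint h hd)
  by_cases h' : a.idx ∈ b.supp
  · rw [basisBracket_comm]
    by_cases hd : Disjoint (b.supp.erase a.idx) a.supp
    · obtain ⟨c, h1, h2, h3⟩ := basisBracket_of_mem h' hd
      exact Or.inr ⟨c, h3, Or.inr ⟨h', hd, h1, h2⟩⟩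
    · exact Or.inl (basisBracket_of_not_disjoint h' hd)
  exact Or.inl (basisBracket_of_notMem h h')

/-- Bracketing with a fixed basis element is injective on the basis elements that it does not
kill. -/
theorem eq_of_isLeftBracket {a a' h c : BasisElt 2 n}
    (ha : IsLeftBracket a h c ∨ IsLeftBracket h a c)
    (ha' : IsLeftBracket a' h c ∨ IsLeftBracket h a' c) : a = a' := by
  rcases ha with ⟨h1, hd, hi, hs⟩ | ⟨h1, hd, hi, hs⟩ <;>
    rcases ha' with ⟨h1', hd', hi', hs'⟩ | ⟨h1', hd', hi', hs'⟩
  · refine BasisElt.ext_supp (hi.symm.trans hi') ?_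
    rw [← Finset.insert_erase h1, ← Finset.insert_erase h1']
    congr 1
    rw [← Finset.union_sdiff_cancel_right hd, ← hs, hs', Finset.union_sdiff_cancel_right hd']
  · have := Finset.mem_Iio.mp (a.supp_subset h1)
    rw [← hi, hi'] at this
    exact absurd this (lt_irrefl _)
  · have := Finset.mem_Iio.mp (a'.supp_subset h1')
    rw [← hi', hi] at this
    exact absurd this (lt_irrefl _)
  · -- the larger of two distinct indices would lie in the support of the element that it indexes
    have key : ∀ {a a' : BasisElt 2 n}, a'.idx ∈ h.supp →
        h.supp.erase a.idx ∪ a.supp = h.supp.erase a'.idx ∪ a'.supp → ¬ a.idx < a'.idx := by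
      intro a a' hm he hlt
      have : a'.idx ∈ h.supp.erase a.idx ∪ a.supp :=
        Finset.mem_union_left _ (Finset.mem_erase.mpr ⟨hlt.ne', hm⟩)
      rw [he] at this
      simp [a'.idx_notMem_supp] at this
    have he := hs.symm.trans hs'
    have hidx : a.idx = a'.idx :=
      le_antisymm (not_lt.mp (key h1 he.symm)) (not_lt.mp (key h1' he))
    refine BasisElt.ext_supp hidx ?_
    rw [← Finset.union_sdiff_cancel_left hd, ← hs, hs', hidx, Finset.union_sdiff_cancel_left hd']

theorem mem_span_toLie {S : Set (BasisElt 2 n)} {z : LieRingOfPartitions 2 n} :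
    z ∈ Submodule.span (ZMod 2) (BasisElt.toLie '' S) ↔ ∀ b, z b ≠ 0 → b ∈ S := by
  have : (BasisElt.toLie : BasisElt 2 n → LieRingOfPartitions 2 n) =
      fun b => Finsupp.single b 1 := rfl
  rw [this, ← Finsupp.supported_eq_span_single, Finsupp.mem_supported]
  simp [Set.subset_def]

/-- The idealizer of a span of basis elements is spanned by basis elements. -/
theorem idealizer_span (S : Set (BasisElt 2 n)) :
    idealizer (Submodule.span (ZMod 2) (BasisElt.toLie '' S)) =
      Submodule.span (ZMod 2) (BasisElt.toLie '' basisIdealizer S) := by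
  apply le_antisymm
  · intro z hz
    rw [mem_span_toLie]
    intro b hb h hh
    rw [bracket_toLie]
    rcases basisBracket_eq_zero_or b h with h0 | ⟨c, hc, hbc⟩
    · exact ⟨0, h, hh, by rw [h0, zero_smul]⟩
    refine ⟨1, c, ?_, by rw [hc, one_smul]⟩
    have hz' := mem_span_toLie.mp
      (hz h.toLie (Submodule.subset_span (Set.mem_image_of_mem _ hh))) c
    apply hz'
    have hsum : bracket 2 n z h.toLie = z.sum fun b' x => x • basisBracket b' h := by
      simp [bracket, BasisElt.toLie, Finsupp.linearCombination_apply, Finsupp.sum,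
        LinearMap.sum_apply]
    rw [hsum, Finsupp.sum_apply, Finsupp.sum, Finset.sum_eq_single b]
    · rw [hc, Finsupp.smul_apply, BasisElt.toLie_apply_self]
      simpa using hb
    · intro b' _ hb'
      rcases basisBracket_eq_zero_or b' h with h0' | ⟨c', hc', hbc'⟩
      · simp [h0']
      · have hne : c' ≠ c := by
          rintro rfl
          exact hb' (eq_of_isLeftBracket hbc' hbc)
        simp [hc', BasisElt.toLie, hne]
    · intro hb'
      simp [Finsupp.notMem_support_iff.mp hb']
  · rw [Submodule.span_le]
    rintro _ ⟨b, hb, rfl⟩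
    have : Submodule.span (ZMod 2) (BasisElt.toLie '' S) ≤
        (Submodule.span (ZMod 2) (BasisElt.toLie '' S)).comap (bracket 2 n b.toLie) := by
      rw [Submodule.span_le]
      rintro _ ⟨h, hh, rfl⟩
      obtain ⟨a, c, hc, he⟩ := hb h hh
      rw [SetLike.mem_coe, Submodule.mem_comap, he]
      exact Submodule.smul_mem _ _ (Submodule.subset_span (Set.mem_image_of_mem _ hc))
    exact fun h hh => this hh

/-! ### The two chains -/

/-- The supports of the members of `S`, sorted by index. -/
def familyOf (S : Set (BasisElt 2 n)) (k : Fin n) : Set (Finset (Fin n)) :=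
  {A | ∃ b ∈ S, b.idx = k ∧ b.supp = A}

theorem supp_mem_familyOf {S : Set (BasisElt 2 n)} {b : BasisElt 2 n} :
    b.supp ∈ familyOf S b.idx ↔ b ∈ S := by
  refine ⟨?_, fun hb => ⟨b, hb, rfl, rfl⟩⟩
  rintro ⟨c, hc, hi, hs⟩
  rwa [← BasisElt.ext_supp hi hs]

theorem familyOf_eq_iff {S : Set (BasisElt 2 n)} {F : Fin n → Set (Finset (Fin n))}
    (hF : ∀ k, ∀ A ∈ F k, A ⊆ Finset.Iio k) :
    familyOf S = F ↔ ∀ b : BasisElt 2 n, b ∈ S ↔ b.supp ∈ F b.idx := by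
  constructor
  · rintro rfl b
    exact supp_mem_familyOf.symm
  · intro h
    funext k
    ext A
    constructor
    · rintro ⟨b, hb, rfl, rfl⟩
      exact (h b).mp hb
    · intro hA
      obtain ⟨b, rfl, rfl⟩ := BasisElt.exists_supp_eq (hF k A hA)
      exact ⟨b, (h b).mpr hA, rfl, rfl⟩

theorem familyOf_injective :
    Function.Injective (familyOf : Set (BasisElt 2 n) → Fin n → Set (Finset (Fin n))) :=
  fun S S' h => Set.ext fun b => by rw [← supp_mem_familyOf, h, supp_mem_familyOf]

theorem toRigid_image (S : Set (BasisElt 2 n)) :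
    RigidComm.toRigid '' S = RigidComm.familyRigid (familyOf S) := by
  ext g
  constructor
  · rintro ⟨b, hb, rfl⟩
    exact ⟨b.idx, b.supp, ⟨b, hb, rfl, rfl⟩, rfl⟩
  · rintro ⟨_, _, ⟨b, hb, rfl, rfl⟩, rfl⟩
    exact ⟨b, hb, rfl⟩

theorem ncard_eq_sum_familyOf (S : Set (BasisElt 2 n)) :
    S.ncard = ∑ k, (familyOf S k).ncard := by
  let φ : S → Σ k, familyOf S k := fun b => ⟨b.1.idx, b.1.supp, b, b.2, rfl, rfl⟩
  have hφ : Function.Bijective φ := by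
    constructor
    · intro b c h
      have h1 : b.1.idx = c.1.idx := congrArg Sigma.fst h
      have h2 : b.1.supp = c.1.supp := congrArg (fun x : Σ k, familyOf S k => x.2.1) h
      exact Subtype.ext (BasisElt.ext_supp h1 h2)
    · rintro ⟨_, _, b, hb, rfl, rfl⟩
      exact ⟨⟨b, hb⟩, rfl⟩
  rw [← Nat.card_coe_set_eq, Nat.card_congr (Equiv.ofBijective φ hφ), Nat.card_sigma]
  exact Finset.sum_congr rfl fun k _ => Nat.card_coe_set_eq _

/-- The Lie bracket of two basis elements vanishes if their monomials overlap, whereas the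
commutator of rigid commutators does not. The overlap makes no difference here, since it can be
removed from one of the monomials: the family is closed under taking divisors, and so is the
idealizer. -/
theorem familyOf_basisIdealizer {S : Set (BasisElt 2 n)}
    (hS : RigidComm.IsClosedFamily (familyOf S)) (h0 : ∀ k, ∅ ∈ familyOf S k) :
    familyOf (basisIdealizer S) = RigidComm.normalizerFamily (familyOf S) := by
  rw [familyOf_eq_iff fun k A hA => hA.1]
  intro b
  constructor
  · intro hb
    -- a nonzero bracket of `b` with an element of `S` is in `S`
    have hmem : ∀ {h c : BasisElt 2 n}, h ∈ S → basisBracket b h = c.toLie → c ∈ S := by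
      intro h c hh hc
      obtain ⟨a, c', hc', he⟩ := hb h hh
      rw [bracket_toLie, hc] at he
      rwa [BasisElt.eq_of_toLie_eq_smul he]
    have hleft : ∀ {j : Fin n} {B : Finset (Fin n)}, B ∈ familyOf S j → j ∈ b.supp →
        b.supp.erase j ∪ B ∈ familyOf S b.idx := by
      intro j B hB hj
      obtain ⟨h, hh, rfl, hsupp⟩ :=
        hS.mem_of_subset h0 hB (Finset.sdiff_subset (t := b.supp.erase j))
      have hd : Disjoint (b.supp.erase h.idx) h.supp := by
        rw [hsupp]; exact Finset.disjoint_sdiff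
      obtain ⟨c, hci, hcs, hc⟩ := basisBracket_of_mem hj hd
      refine ⟨c, hmem hh hc, hci, ?_⟩
      rw [hcs, hsupp, Finset.union_sdiff_self_eq_union]
    refine ⟨b.supp_subset, fun j B hB => ⟨hleft hB, fun hk => ?_⟩⟩
    by_cases hd : Disjoint (B.erase b.idx) b.supp
    · obtain ⟨h, hh, rfl, rfl⟩ := hB
      obtain ⟨c, hci, hcs, hc⟩ := basisBracket_of_mem hk hd
      rw [basisBracket_comm] at hc
      exact ⟨c, hmem hh hc, hci, hcs⟩
    · obtain ⟨x, hxB, hxb⟩ := Finset.not_disjoint_iff.mp hd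
      have h1 := hleft (h0 x) hxb
      rw [Finset.union_empty] at h1
      have h2 := hS.mem_of_subset h0 h1 (B := b.supp \ B.erase b.idx) (fun i hi => by
        rw [Finset.mem_sdiff] at hi
        exact Finset.mem_erase.mpr ⟨fun h => hi.2 (h ▸ hxB), hi.1⟩)
      have h3 := hS.erase_union_mem hB hk h2
      rwa [Finset.union_sdiff_self_eq_union] at h3
  · intro hb h hh
    rw [bracket_toLie]
    rcases basisBracket_eq_zero_or b h with hz | ⟨c, hc, hbc⟩
    · exact ⟨0, h, hh, by rw [hz, zero_smul]⟩
    refine ⟨1, c, supp_mem_familyOf.mp ?_, by rw [hc, one_smul]⟩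
    have hh' := hb.2 h.idx h.supp (supp_mem_familyOf.mpr hh)
    rcases hbc with ⟨hm, -, hi, hs⟩ | ⟨hm, -, hi, hs⟩
    · rw [hi, hs]
      exact hh'.1 hm
    · rw [hi, hs]
      exact hh'.2 hm

theorem familyOf_basisT : familyOf (basisT 2 n) = RigidComm.constFamily n := by
  rw [familyOf_eq_iff fun k A hA => RigidComm.isClosedFamily_const.subset_Iio hA]
  intro b
  simp only [basisT, Set.mem_ofPred_eq, RigidComm.constFamily, Set.mem_singleton_iff]
  rw [Finset.eq_empty_iff_forall_notMem, funext_iff]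
  exact forall_congr' fun j => BasisElt.notMem_supp.symm

theorem familyOf_basisU :
    familyOf (basisU 2 n) = RigidComm.normalizerFamily (RigidComm.constFamily n) := by
  rw [familyOf_eq_iff fun k A hA => hA.1]
  intro b
  have h1 : b ∈ basisT 2 n ↔ b.supp = ∅ := by
    rw [← supp_mem_familyOf, familyOf_basisT]; rfl
  have h2 : ∀ j, b.expo = Pi.single j 1 ↔ b.supp = {j} := by
    intro j
    constructor
    · intro h
      ext i
      rw [BasisElt.mem_supp, h, Finset.mem_singleton, Pi.single_apply]
      split_ifs <;> simp_all
    · intro h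
      funext i
      rcases eq_or_ne i j with rfl | hi
      · rw [Pi.single_eq_same, BasisElt.mem_supp.mp (by simp [h])]
      · rw [Pi.single_eq_of_ne hi, BasisElt.notMem_supp.mp (by simp [h, hi])]
  simp only [basisU, Set.mem_union, h1, Set.mem_ofPred_eq, h2, RigidComm.normalizerFamily,
    RigidComm.constFamily, Set.mem_singleton_iff, forall_eq, Finset.union_empty,
    Finset.notMem_empty, false_imp_iff, and_true, b.supp_subset, true_and]
  constructor
  · rintro (h | ⟨j, h⟩) i hi <;> simp_all
  · intro h
    rcases b.supp.eq_empty_or_nonempty with he | ⟨j, hj⟩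
    · exact Or.inl he
    · exact Or.inr ⟨j, by rw [← Finset.insert_erase hj, h j hj]; rfl⟩

theorem basisU_eq_basisIdealizer : basisU 2 n = basisIdealizer (basisT 2 n) := by
  apply familyOf_injective
  rw [familyOf_basisU, familyOf_basisIdealizer, familyOf_basisT]
  · rw [familyOf_basisT]; exact RigidComm.isClosedFamily_const
  · rw [familyOf_basisT]; exact fun _ => rfl

theorem isClosedFamily_basisChain (i : ℕ) :
    RigidComm.IsClosedFamily (familyOf (basisChain 2 n i)) ∧
      ∀ k, ∅ ∈ familyOf (basisChain 2 n i) k := by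
  induction i with
  | zero =>
    rw [basisChain, familyOf_basisU]
    exact ⟨RigidComm.isClosedFamily_const.isClosedFamily_normalizerFamily fun _ => rfl,
      fun k => RigidComm.isClosedFamily_const.le_normalizerFamily k rfl⟩
  | succ i ih =>
    rw [basisChain, familyOf_basisIdealizer ih.1 ih.2]
    exact ⟨ih.1.isClosedFamily_normalizerFamily ih.2, fun k => ih.1.le_normalizerFamily k (ih.2 k)⟩

theorem basisChain_subset_succ (i : ℕ) : basisChain 2 n i ⊆ basisChain 2 n (i + 1) := by
  intro b hb
  obtain ⟨hc, h0⟩ := isClosedFamily_basisChain (n := n) i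
  rw [← supp_mem_familyOf, basisChain, familyOf_basisIdealizer hc h0]
  exact hc.le_normalizerFamily _ (supp_mem_familyOf.mpr hb)

theorem idealizerChain_eq_span (i : ℕ) : idealizerChain 2 n i =
    Submodule.span (ZMod 2) (BasisElt.toLie '' basisChain 2 n i) := by
  induction i with
  | zero => rw [idealizerChain, idealizer_span, basisChain, basisU_eq_basisIdealizer]
  | succ i ih => rw [idealizerChain, ih, idealizer_span, basisChain]

instance : Finite (BasisElt 2 n) :=
  Finite.of_injective (fun b : BasisElt 2 n => (b.idx, b.supp)) fun _ _ h =>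
    BasisElt.ext_supp (congrArg Prod.fst h) (congrArg Prod.snd h)

theorem finrank_span_toLie (S : Set (BasisElt 2 n)) :
    Module.finrank (ZMod 2) (Submodule.span (ZMod 2) (BasisElt.toLie '' S)) = S.ncard := by
  classical
  have hli : LinearIndependent (ZMod 2) fun b : S => (b : BasisElt 2 n).toLie :=
    (Finsupp.basisSingleOne (R := ZMod 2)).linearIndependent.comp _ Subtype.val_injective
  have : Fintype S := Fintype.ofFinite S
  rw [Set.image_eq_range, finrank_span_eq_card hli, Set.ncard_eq_toFinset_card',
    Set.toFinset_card]

theorem quotientRank_span {S S' : Set (BasisElt 2 n)} (h : S ⊆ S') :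
    quotientRank (Submodule.span (ZMod 2) (BasisElt.toLie '' S'))
      (Submodule.span (ZMod 2) (BasisElt.toLie '' S)) + S.ncard = S'.ncard := by
  have hle : Submodule.span (ZMod 2) (BasisElt.toLie '' S) ≤
      Submodule.span (ZMod 2) (BasisElt.toLie '' S') :=
    Submodule.span_mono (Set.image_mono h)
  rw [← finrank_span_toLie S', ← finrank_span_toLie S, quotientRank,
    ← LinearEquiv.finrank_eq (Submodule.submoduleOfEquivOfLe hle)]
  exact Submodule.finrank_quotient_add_finrank _

end PartLie

namespace RigidComm

open PartLie

variable {n : ℕ}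

/-- The normalizer chain of the translations consists of the groups of the sets `𝓝_i`. -/
theorem normalizerChain_std (i : ℕ) : normalizerChain (stdSylow n) (stdT n) i =
    Subgroup.closure (familyRigid (familyOf (basisChain 2 n i))) := by
  induction i with
  | zero =>
    rw [normalizerChain, stdSylow_eq_triangular, stdT_eq_closure,
      isClosedFamily_const.normalizer_closure fun _ => rfl, basisChain, familyOf_basisU]
  | succ i ih =>
    obtain ⟨hc, h0⟩ := isClosedFamily_basisChain (n := n) i
    rw [normalizerChain, ih, stdSylow_eq_triangular, hc.normalizer_closure h0, basisChain,
      familyOf_basisIdealizer hc h0]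

theorem card_normalizerChain_std (i : ℕ) :
    Nat.card (normalizerChain (stdSylow n) (stdT n) i) = 2 ^ (basisChain 2 n i).ncard := by
  rw [normalizerChain_std, (isClosedFamily_basisChain i).1.card_closure, ncard_eq_sum_familyOf]

end RigidComm

namespace RigidComm

open scoped Pointwise

variable {n : ℕ}

/-! ### Sylow subgroups and their elementary abelian regular subgroups -/

theorem mem_transport {α β : Type*} {e : α ≃ β} {H : Subgroup (Equiv.Perm α)}
    {g : Equiv.Perm β} : g ∈ transport e H ↔ e.symm.permCongr g ∈ H :=
  Subgroup.mem_map_equiv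

theorem transport_trans {α β γ : Type*} (e : α ≃ β) (f : β ≃ γ) (H : Subgroup (Equiv.Perm α)) :
    transport (e.trans f) H = transport f (transport e H) := by
  ext g
  simp only [mem_transport]
  rfl

theorem card_transport {α β : Type*} (e : α ≃ β) (H : Subgroup (Equiv.Perm α)) :
    Nat.card (transport e H) = Nat.card H :=
  Nat.card_congr (H.equivMapOfInjective _ e.permCongrHom.injective).toEquiv.symm

theorem transport_perm {α : Type*} (f : Equiv.Perm α) (H : Subgroup (Equiv.Perm α)) :
    transport f H = MulAut.conj f • H := by
  ext g
  rw [mem_transport, Subgroup.mem_pointwise_smul_iff_inv_smul_mem]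
  rfl

theorem transport_normalizerChain {α β : Type*} (e : α ≃ β) (S T : Subgroup (Equiv.Perm α))
    (i : ℕ) : transport e (normalizerChain S T i) =
      normalizerChain (transport e S) (transport e T) i := by
  have key : ∀ K : Subgroup (Equiv.Perm α),
      transport e (S ⊓ Subgroup.normalizer (K : Set (Equiv.Perm α))) =
        transport e S ⊓ Subgroup.normalizer (transport e K : Set (Equiv.Perm β)) := by
    intro K
    rw [transport, Subgroup.map_inf _ _ _ e.permCongrHom.injective]
    congr 1
    exact Subgroup.map_equiv_normalizer_eq K e.permCongrHom
  induction i with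
  | zero => exact key T
  | succ i ih => rw [normalizerChain, key, ih, normalizerChain]

theorem IsElementaryAbelianTwo.transport {α β : Type*} (e : α ≃ β)
    {T : Subgroup (Equiv.Perm α)} (hT : IsElementaryAbelianTwo T) :
    IsElementaryAbelianTwo (transport e T) := by
  constructor
  · rintro _ ⟨g, hg, rfl⟩ _ ⟨h, hh, rfl⟩
    rw [← map_mul, ← map_mul, hT.1 g hg h hh]
  · rintro _ ⟨g, hg, rfl⟩
    rw [← map_pow, hT.2 g hg, map_one]

theorem IsRegular.transport {α β : Type*} (e : α ≃ β) {T : Subgroup (Equiv.Perm α)}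
    (hT : IsRegular T) : IsRegular (transport e T) := by
  intro x y
  obtain ⟨g, ⟨hg, hgx⟩, huniq⟩ := hT (e.symm x) (e.symm y)
  refine ⟨e.permCongr g, ⟨⟨g, hg, rfl⟩, by simp [Equiv.permCongr_apply, hgx]⟩, ?_⟩
  rintro _ ⟨⟨h, hh, rfl⟩, hhx⟩
  rw [← huniq h ⟨hh, by rw [← hhx]; exact (e.symm_apply_apply _).symm⟩]
  rfl

theorem card_triangular : Nat.card (triangular n) = 2 ^ (2 ^ n - 1) := by
  rw [← closure_fullFamily, isClosedFamily_full.card_closure]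
  congr 1
  have h : ∀ k : Fin n, (fullFamily n k).ncard = 2 ^ (k : ℕ) := by
    intro k
    have : fullFamily n k = ((Finset.Iio k).powerset : Set (Finset (Fin n))) := by
      ext A
      rw [Finset.mem_coe, Finset.mem_powerset]
      rfl
    rw [this, Set.ncard_coe_finset, Finset.card_powerset, Fin.card_Iio]
  simp only [h]
  rw [Fin.sum_univ_eq_sum_range (fun k => 2 ^ k), Nat.geomSum_eq le_rfl, Nat.div_one]

theorem factorization_two_pow_factorial (n : ℕ) :
    (Nat.factorial (2 ^ n)).factorization 2 = 2 ^ n - 1 := by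
  rw [Nat.factorization_def _ Nat.prime_two]
  induction n with
  | zero => simp
  | succ n ih =>
    rw [pow_succ', padicValNat_factorial_mul, ih]
    have := Nat.one_le_two_pow (n := n)
    omega

theorem card_perm_word : Nat.card (Equiv.Perm (Word n)) = Nat.factorial (2 ^ n) := by
  rw [Nat.card_perm, Nat.card_eq_fintype_card]
  simp

/-- Every Sylow `2`-subgroup of the symmetric group on `2 ^ n` points is the group of triangular
permutations for a suitable labelling of the points. -/
theorem exists_transport_eq_triangular (S : Sylow 2 (Equiv.Perm (Fin (2 ^ n)))) :
    ∃ e : Fin (2 ^ n) ≃ Word n, transport e (S : Subgroup _) = triangular n := by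
  let e₀ : Fin (2 ^ n) ≃ Word n := Fintype.equivOfCardEq (by simp)
  have hS : Nat.card (transport e₀ (S : Subgroup (Equiv.Perm (Fin (2 ^ n))))) =
      2 ^ (Nat.card (Equiv.Perm (Word n))).factorization 2 := by
    rw [card_transport, S.card_eq_multiplicity, Nat.card_congr e₀.permCongr]
  have hU : Nat.card (triangular n) = 2 ^ (Nat.card (Equiv.Perm (Word n))).factorization 2 := by
    rw [card_triangular, card_perm_word, factorization_two_pow_factorial]
  obtain ⟨f, hf⟩ := MulAction.exists_smul_eq (Equiv.Perm (Word n))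
    (Sylow.ofCard _ hS) (Sylow.ofCard _ hU)
  refine ⟨e₀.trans f, ?_⟩
  rw [transport_trans, transport_perm]
  have := congrArg (fun P : Sylow 2 (Equiv.Perm (Word n)) => (P : Subgroup (Equiv.Perm (Word n)))) hf
  simpa only [Sylow.coe_subgroup_smul, Sylow.coe_ofCard] using this

/-- A triangular permutation with image `e_j` of the zero word acts on the first nonzero letter of
a word as the translation by `e_j` does, provided that `j` does not precede that letter. -/
theorem apply_eq_add_single_of_apply_zero {t : Equiv.Perm (Word n)} (ht : t ∈ triangular n)
    {j : Fin n} (h0 : t 0 = Pi.single j 1) {k : Fin n} {p : Word n} (hp : ∀ i < k, p i = 0)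
    {i : Fin n} (hi : i ≤ k) : t p i = p i + (Pi.single j 1 : Word n) i := by
  rw [apply_eq_add_component, ht i (y := 0) fun l hl => hp l (lt_of_lt_of_le hl hi), component, h0,
    Pi.zero_apply, add_zero]

/-- An elementary abelian regular group of triangular permutations is conjugate to the group of
translations by a triangular permutation: writing `t_v = ∏ j, t_j ^ v_j`, where `t_j` maps the zero
word to `e_j`, the permutation `v ↦ t_v 0` does it. -/
theorem exists_transport_eq_stdT {T : Subgroup (Equiv.Perm (Word n))} (hTU : T ≤ triangular n)
    (hT : IsElementaryAbelianTwo T) (hreg : IsRegular T) :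
    ∃ f ∈ triangular n, transport f T = stdT n := by
  let : CommGroup T := { (inferInstance : Group T) with
    mul_comm := fun a b => Subtype.ext (hT.1 a a.2 b b.2) }
  have hex : ∀ j : Fin n, ∃ t : T, t.1 0 = Pi.single j 1 := fun j => by
    obtain ⟨g, ⟨hg, hg0⟩, -⟩ := hreg 0 (Pi.single j 1)
    exact ⟨⟨g, hg⟩, hg0⟩
  choose t ht using hex
  set φ : Word n → T := fun v => ∏ j, t j ^ (v j).val with hφ
  have hadd : ∀ u v, φ (u + v) = φ u * φ v := by
    intro u v
    simp only [hφ, ← Finset.prod_mul_distrib]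
    refine Finset.prod_congr rfl fun j _ => ?_
    have hsq : t j ^ 2 = 1 := Subtype.ext (hT.2 _ (t j).2)
    rw [Pi.add_apply, ZMod.val_add, ← pow_add, ← pow_eq_pow_mod _ hsq]
  have hlead : ∀ {k : Fin n} {d : Word n}, (∀ i < k, d i = 0) → ∀ s : Finset (Fin n),
      (∀ i < k, (∏ j ∈ s, t j ^ (d j).val : T).1 0 i = 0) ∧
        (∏ j ∈ s, t j ^ (d j).val : T).1 0 k = if k ∈ s then d k else 0 := by
    intro k d hd s
    induction s using Finset.induction_on with
    | empty => simp
    | insert j s hj ih =>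
      rw [Finset.prod_insert hj]
      have hdj : d j = 0 ∨ d j = 1 := by generalize d j = a; revert a; decide
      rcases hdj with h | h
      · rw [h, ZMod.val_zero, pow_zero, one_mul]
        refine ⟨ih.1, ih.2.trans ?_⟩
        rcases eq_or_ne k j with rfl | hkj
        · simp [hj, h]
        · simp [hkj]
      · have hkj : k ≤ j := not_lt.mp fun hjk => by simp [hd j hjk] at h
        have hval : (1 : ZMod 2).val = 1 := rfl
        rw [h, hval, pow_one]
        have hstep := fun i hi => apply_eq_add_single_of_apply_zero (hTU (t j).2) (ht j) ih.1
          (i := i) hi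
        refine ⟨fun i hi => (hstep i hi.le).trans ?_, (hstep k le_rfl).trans ?_⟩
        · rw [ih.1 i hi, Pi.single_eq_of_ne (lt_of_lt_of_le hi hkj).ne, add_zero]
        · rw [ih.2]
          rcases eq_or_ne k j with rfl | hne
          · simp [hj, h]
          · simp [hne]
  have hdep : ∀ k, DependsOn (fun v : Word n => (φ v).1 0 k + v k) (Set.Iio k) := by
    intro k v w hvw
    have hd : ∀ i < k, (v + w) i = 0 := fun i hi => by
      rw [Pi.add_apply, hvw i hi, CharTwo.add_self_eq_zero]
    have hw : w = v + (v + w) := by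
      rw [← add_assoc, ZModModule.add_self, zero_add]
    obtain ⟨h1, h2⟩ := hlead hd Finset.univ
    have h3 : (φ w).1 0 k = (φ v).1 ((φ (v + w)).1 0) k := by
      conv_lhs => rw [hw, hadd]
      rfl
    have h4 : component k (φ v).1 ((φ (v + w)).1 0) = component k (φ v).1 0 :=
      hTU (φ v).2 k h1
    simp only [h3]
    rw [apply_eq_add_component (φ v).1 ((φ (v + w)).1 0), h4, h2, if_pos (Finset.mem_univ k),
      component, Pi.zero_apply, Pi.add_apply]
    have h5 : ∀ a b c : ZMod 2, a + b = b + c + (a + 0) + c := by decide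
    exact h5 _ _ _
  obtain ⟨ψ, hψ⟩ := exists_perm_component hdep
  have hψφ : ∀ v, ψ v = (φ v).1 0 := fun v => funext fun k => by
    rw [apply_eq_add_component, hψ, add_comm, add_assoc, CharTwo.add_self_eq_zero, add_zero]
  have hconj : ∀ u w, (φ u).1 (ψ w) = ψ (w + u) := fun u w => by
    rw [hψφ, hψφ, add_comm, hadd]; rfl
  have hψU : ψ ∈ triangular n := fun k => by rw [hψ]; exact hdep k
  refine ⟨ψ⁻¹, inv_mem hψU, ?_⟩
  ext g
  rw [mem_stdT, mem_transport]
  have happ : ∀ x, ψ.permCongr g x = ψ (g (ψ.symm x)) := fun x => rfl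
  change ψ.permCongr g ∈ T ↔ _
  constructor
  · intro hg
    set u := ψ.symm (ψ.permCongr g 0) with hu
    have heq : (φ u).1 = ψ.permCongr g :=
      (hreg 0 (ψ.permCongr g 0)).unique ⟨(φ u).2, by rw [← hψφ, hu, ψ.apply_symm_apply]⟩ ⟨hg, rfl⟩
    refine ⟨u, fun w => ψ.injective ?_⟩
    rw [← hconj, heq, happ, ψ.symm_apply_apply]
  · rintro ⟨u, hu⟩
    have heq : ψ.permCongr g = (φ u).1 := Equiv.ext fun x => by
      rw [happ, hu, ← hconj, ψ.apply_symm_apply]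
    rw [heq]
    exact (φ u).2

theorem exists_transport_eq_std (S : Sylow 2 (Equiv.Perm (Fin (2 ^ n))))
    {T : Subgroup (Equiv.Perm (Fin (2 ^ n)))} (hTS : T ≤ (S : Subgroup _))
    (hT : IsElementaryAbelianTwo T) (hreg : IsRegular T) :
    ∃ e : Fin (2 ^ n) ≃ Word n, transport e (S : Subgroup _) = stdSylow n ∧
      transport e T = stdT n := by
  obtain ⟨e, he⟩ := exists_transport_eq_triangular S
  obtain ⟨f, hf, hfT⟩ := exists_transport_eq_stdT (T := transport e T)
    (he ▸ Subgroup.map_mono hTS) (hT.transport e) (hreg.transport e)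
  refine ⟨e.trans f, ?_, by rw [transport_trans, hfT]⟩
  rw [transport_trans, he, transport_perm, stdSylow_eq_triangular]
  exact Subgroup.conj_smul_eq_self_of_mem hf

theorem two_pow_mul_relIndex (S : Sylow 2 (Equiv.Perm (Fin (2 ^ n))))
    {T : Subgroup (Equiv.Perm (Fin (2 ^ n)))} {e : Fin (2 ^ n) ≃ Word n}
    (heS : transport e (S : Subgroup _) = stdSylow n) (heT : transport e T = stdT n) (i : ℕ) :
    2 ^ (PartLie.basisChain 2 n i).ncard *
        (normalizerChain (S : Subgroup _) T i).relIndex (normalizerChain (S : Subgroup _) T (i + 1)) =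
      2 ^ (PartLie.basisChain 2 n (i + 1)).ncard := by
  have hcard : ∀ i, Nat.card (normalizerChain (S : Subgroup _) T i) =
      2 ^ (PartLie.basisChain 2 n i).ncard := fun i => by
    rw [← card_transport e, transport_normalizerChain, heS, heT, card_normalizerChain_std]
  have hle : normalizerChain (S : Subgroup _) T i ≤ normalizerChain (S : Subgroup _) T (i + 1) := by
    refine le_inf ?_ Subgroup.le_normalizer
    cases i <;> exact inf_le_left
  rw [← hcard, ← hcard, ← Subgroup.relIndex_bot_left, ← Subgroup.relIndex_bot_left,
    Subgroup.relIndex_mul_relIndex _ _ _ bot_le hle]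

end RigidComm

theorem mainTheorem5 (n : ℕ)
    (S : Sylow 2 (Equiv.Perm (Fin (2 ^ n)))) (T : Subgroup (Equiv.Perm (Fin (2 ^ n))))
    (hTS : T ≤ (S : Subgroup (Equiv.Perm (Fin (2 ^ n)))))
    (hT : RigidComm.IsElementaryAbelianTwo T) (hreg : RigidComm.IsRegular T) :
    (∃ e : Fin (2 ^ n) ≃ RigidComm.Word n,
      RigidComm.transport e (S : Subgroup (Equiv.Perm (Fin (2 ^ n)))) = RigidComm.stdSylow n ∧
      RigidComm.transport e T = RigidComm.stdT n) ∧
    (∀ e : Fin (2 ^ n) ≃ RigidComm.Word n,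
      RigidComm.transport e (S : Subgroup (Equiv.Perm (Fin (2 ^ n)))) = RigidComm.stdSylow n →
      RigidComm.transport e T = RigidComm.stdT n →
      ∀ i : ℕ,
        RigidComm.IsSaturated (RigidComm.toRigid '' PartLie.basisChain 2 n i) ∧
        RigidComm.transport e (RigidComm.normalizerChain (S : Subgroup _) T i) =
          Subgroup.closure (RigidComm.toRigid '' PartLie.basisChain 2 n i) ∧
        {g ∈ RigidComm.rigidCommutators n |
          g ∈ RigidComm.transport e (RigidComm.normalizerChain (S : Subgroup _) T i)} =
          RigidComm.toRigid '' PartLie.basisChain 2 n i) ∧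
    ∀ i : ℕ, 1 ≤ i →
      (PartLie.quotientRank (PartLie.idealizerChain 2 n i) (PartLie.idealizerChain 2 n (i - 1)) : ℝ) =
      Real.logb 2 ((RigidComm.normalizerChain (S : Subgroup _) T (i - 1)).relIndex
        (RigidComm.normalizerChain (S : Subgroup _) T i) : ℝ) := by
  have hstd := RigidComm.exists_transport_eq_std S hTS hT hreg
  refine ⟨hstd, fun e heS heT i => ?_, fun i hi => ?_⟩
  · obtain ⟨hc, -⟩ := PartLie.isClosedFamily_basisChain (n := n) i
    rw [RigidComm.transport_normalizerChain, heS, heT, RigidComm.normalizerChain_std,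
      PartLie.toRigid_image]
    refine ⟨⟨?_, fun g hg h hh => hc.commutator_mem hg hh⟩, rfl, ?_⟩
    · rintro _ ⟨k, A, hA, rfl⟩
      exact ⟨k, A, hc.subset_Iio hA, rfl⟩
    · ext g
      constructor
      · rintro ⟨⟨k, A, hA, rfl⟩, hg⟩
        exact ⟨k, A, (hc.punctured_mem_closure_iff hA).mp hg, rfl⟩
      · rintro ⟨k, A, hA, rfl⟩
        exact ⟨⟨k, A, hc.subset_Iio hA, rfl⟩, Subgroup.subset_closure ⟨k, A, hA, rfl⟩⟩
  · obtain ⟨e, heS, heT⟩ := hstd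
    obtain ⟨i, rfl⟩ := Nat.exists_eq_add_of_le' hi
    rw [Nat.add_sub_cancel]
    have h1 := RigidComm.two_pow_mul_relIndex S heS heT i
    have h2 := PartLie.quotientRank_span (PartLie.basisChain_subset_succ (n := n) i)
    rw [← PartLie.idealizerChain_eq_span, ← PartLie.idealizerChain_eq_span] at h2
    rw [← h2, Nat.add_comm (PartLie.quotientRank _ _), pow_add] at h1
    rw [Nat.eq_of_mul_eq_mul_left (Nat.two_pow_pos _) h1, Nat.cast_pow, Nat.cast_ofNat,
      Real.logb_pow, Real.logb_self_eq_one one_lt_two, mul_one]
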